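/- Let $(M,g)$ be a smooth four-dimensional Lorentzian manifold of signature $(-,+,+,+)$ with Levi-Civita connection $\nabla$, and let $\mathcal D\subset M$ be a convex normal neighbourhood: an open set such that any two points $p,q\in\mathcal D$ are joined by exactly one (affinely parametrised) geodesic $[0,1]\to\mathcal D$, that is a normal neighbourhood of each of its points, with $\exp_p^{-1}q$ smooth in $(p,q)\in\mathcal D\times\mathcal D$. For $x,x'\in\mathcal D$ let $$\Sigma(x,x')=\tfrac12\, g_{x'}\big(\exp_{x'}^{-1}x,\exp_{x'}^{-1}x\big)$$ be half the (signed) squared geodesic distance, so $\Sigma>0$ for spacelike and $\Sigma<0$ for timelike separated points. Let $m,\xi\in\mathbb R$, let $U=\Delta^{1/2}$ with $$\Delta(x,x')=-\frac{\det\big(-\nabla_\mu\nabla_{\nu'}\Sigma(x,x')\big)}{\sqrt{-g(x)}\sqrt{-g(x')}}$$ the van Vleck-Morette determinant, and let $V$ be a smooth function on $\mathcal D\times\mathcal D$ with the asymptotic expansion $V\sim\sum_{n\ge0}V_n\Sigma^n$ (for every $N$, $V-\sum_{n<N}V_n\Sigma^n$ is $\Sigma^N$ times a smooth function on $\mathcal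 D\times\mathcal D$), where the $V_n$ are smooth on $\mathcal D\times\mathcal D$ and satisfy the Hadamard recursion relations for $P=\Box-m^2-\xi R$ (all derivatives at $x$, $R$ the scalar curvature): $$2\nabla^aV_0\nabla_a\Sigma+V_0(\Box\Sigma-2)+PU=0,$$ $$(n+1)\big(2\nabla^aV_{n+1}\nabla_a\Sigma+V_{n+1}(\Box\Sigma+2n)\big)+PV_n=0\quad(n\ge0).$$ Let $T$ be a $C^1$ time function on $\mathcal D$ (its gradient is timelike) and $\ell>0$, and let $$H^\ell(x,x')=\lim_{\epsilon\to0^+}\frac1{8\pi^2}\left(\frac{U}{\Sigma+2i\epsilon(T(x)-T(x'))+\epsilon^2}+V\log\frac{\Sigma+2i\epsilon(T(x)-T(x'))+\epsilon^2}{\ell^2}\right)$$ (with the principal branch of $\log$) be the Hadamard parametrix, considered off the light cone $\Sigma=0$. A $C^n$ function $B$ on $\mathcal D\times\mathcal D$ is called an order-$n$ split-point approximation of a $C^n$ function $A$ on $\mathcal D\times\mathcal D$ if, for all $0\le k\le n$ and all $x\in\mathcal D$, $$\lim_{x'\to x}\nabla_{a_k}\cdots\nabla_{a_1}B(x,x')=\lim_{x'\to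 x}\nabla_{a_k}\cdots\nabla_{a_1}A(x,x'),$$ the derivatives acting at $x$. Let $\tilde\Sigma,\tilde U,\tilde V$ be split-point approximations of $\Sigma,U,V$ of orders $n_\Sigma\ge6$, $n_U\ge4$, $n_V\ge2$, and let $\tilde V$ be of class $C^3$ on $\mathcal D\times\mathcal D$. Put $$\tilde H^\ell(x,x')=\frac1{2(2\pi)^2}\left(\frac{\tilde U(x,x')}{\tilde\Sigma(x,x')}+\tilde V(x,x')\log\frac{\tilde\Sigma(x,x')}{\ell^2}\right),$$ where for $\tilde\Sigma<0$ the logarithm is taken with imaginary part $\pi\,\mathrm{sgn}(T(x)-T(x'))$, the branch that occurs in $H^\ell$. Then $$\big[\nabla_a\nabla_b(H^\ell-\tilde H^\ell)\big]=0,$$ the coincidence limit being taken along arbitrary non-null trajectories: for every $x\in\mathcal D$ and every curve $\gamma:\mathbb R\to M$ with $\gamma(0)=x$ that is differentiable at $0$ with $g(\gamma'(0),\gamma'(0))\ne0$, the function $y\mapsto(H^\ell-\tilde H^\ell)(y,\gamma(t))$ is $C^2$ near $y=x$ for all sufficiently small $t\ne0$, and $$\lim_{t\to0}\,\nabla_a\nabla_b\big(H^\ell-\tilde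 H^\ell\big)(x,\gamma(t))=0 .$$ -/

import Mathlib

open Set Filter Topology Bundle
open scoped Manifold ContDiff

noncomputable section

namespace PointSplitting

/-- The model space of a four-dimensional spacetime. -/
abbrev E4 : Type := EuclideanSpace ℝ (Fin 4)

/-- The coordinate vector `e_μ` of the model space. -/
def e (μ : Fin 4) : E4 := EuclideanSpace.single μ (1 : ℝ)

/-! ### Lorentzian metrics and their local expressions -/

section Metric

/-- A smooth Lorentzian metric of signature `(-,+,+,+)` on a four-dimensional manifold. -/
structure LorentzMetric (M : Type*) [TopologicalSpace M] [ChartedSpace E4 M]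
    [IsManifold (𝓡 4) ∞ M] where
  /-- The bilinear form on each tangent space. -/
  val (x : M) : TangentSpace (𝓡 4) x →L[ℝ] TangentSpace (𝓡 4) x →L[ℝ] ℝ
  symm (x : M) (v w : TangentSpace (𝓡 4) x) : val x v w = val x w v
  signature (x : M) : ∃ b : Module.Basis (Fin 4) ℝ (TangentSpace (𝓡 4) x),
    ∀ i j : Fin 4, val x (b i) (b j) = if i = j then (if i = 0 then -1 else 1) else 0
  contMDiff : ContMDiff (𝓡 4) ((𝓡 4).prod 𝓘(ℝ, E4 →L[ℝ] E4 →L[ℝ] ℝ)) ∞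
    (fun x ↦ TotalSpace.mk' (E4 →L[ℝ] E4 →L[ℝ] ℝ) x (val x))

variable {M : Type*} [TopologicalSpace M] [ChartedSpace E4 M] [IsManifold (𝓡 4) ∞ M]

/-- The coordinate vector field `∂_μ` of the preferred chart at `c`, at the point with
coordinates `y`. -/
def coordVec (c : M) (y : E4) (μ : Fin 4) :
    TangentSpace (𝓡 4) ((extChartAt (𝓡 4) c).symm y) :=
  mfderiv 𝓘(ℝ, E4) (𝓡 4) (extChartAt (𝓡 4) c).symm y (e μ)

/-- The matrix `g_{μν}` of the metric in the preferred chart at `c`. -/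
def metricMatrix (g : LorentzMetric M) (c : M) (y : E4) : Matrix (Fin 4) (Fin 4) ℝ :=
  Matrix.of fun μ ν ↦
    g.val ((extChartAt (𝓡 4) c).symm y) (coordVec c y μ) (coordVec c y ν)

/-- Partial derivative `∂_μ f` on the model space. -/
def pderiv {F : Type*} [NormedAddCommGroup F] [NormedSpace ℝ F] (μ : Fin 4) (f : E4 → F)
    (y : E4) : F :=
  fderiv ℝ f y (e μ)

/-- The Christoffel symbols `Γ^l_{μν}` of the Levi-Civita connection in the preferred chart
at `c`. -/
def christoffel (g : LorentzMetric M) (c : M) (l μ ν : Fin 4) (y : E4) : ℝ :=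
  (1 / 2) * ∑ s : Fin 4, (metricMatrix g c y)⁻¹ l s *
    (pderiv μ (fun z ↦ metricMatrix g c z s ν) y + pderiv ν (fun z ↦ metricMatrix g c z s μ) y
      - pderiv s (fun z ↦ metricMatrix g c z μ ν) y)

/-- The components `∇_{a 0} ∇_{a 1} ⋯ ∇_{a (k-1)} f` of the iterated covariant derivative of a
function, whose expression in the preferred chart at `c` is `f`, in that chart. -/
def covD {F : Type*} [NormedAddCommGroup F] [NormedSpace ℝ F] (g : LorentzMetric M) (c : M)
    (f : E4 → F) : (k : ℕ) → (Fin k → Fin 4) → E4 → F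
  | 0, _, y => f y
  | k + 1, a, y =>
      pderiv (a 0) (covD g c f k (Fin.tail a)) y
        - ∑ i : Fin k, ∑ l : Fin 4,
            christoffel g c l (a 0) (Fin.tail a i) y •
              covD g c f k (Function.update (Fin.tail a) i l) y

/-- The components at `x` of the `k`-th iterated covariant derivative of a function on `M`, in the
preferred chart at `x`. -/
def nablaAt {F : Type*} [NormedAddCommGroup F] [NormedSpace ℝ F] (g : LorentzMetric M)
    (k : ℕ) (a : Fin k → Fin 4) (f : M → F) (x : M) : F :=
  covD g x (fun y ↦ f ((extChartAt (𝓡 4) x).symm y)) k a (extChartAt (𝓡 4) x x)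

/-- The scalar product `g^{ab} (∇_a f) (∇_b h)` at `x`. -/
def gradInner (g : LorentzMetric M) (f h : M → ℝ) (x : M) : ℝ :=
  ∑ a : Fin 4, ∑ b : Fin 4, (metricMatrix g x (extChartAt (𝓡 4) x x))⁻¹ a b *
    nablaAt g 1 ![a] f x * nablaAt g 1 ![b] h x

/-- The wave operator `□ f = g^{ab} ∇_a ∇_b f` at `x`. -/
def box (g : LorentzMetric M) (f : M → ℝ) (x : M) : ℝ :=
  ∑ a : Fin 4, ∑ b : Fin 4, (metricMatrix g x (extChartAt (𝓡 4) x x))⁻¹ a b *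
    nablaAt g 2 ![a, b] f x

/-- The Ricci tensor in the preferred chart at `c`, with the sign for which round spheres have
positive curvature. -/
def ricci (g : LorentzMetric M) (c : M) (μ ν : Fin 4) (y : E4) : ℝ :=
  ∑ l : Fin 4, (pderiv l (christoffel g c l μ ν) y - pderiv μ (christoffel g c l l ν) y
    + ∑ s : Fin 4, (christoffel g c s μ ν y * christoffel g c l s l y
        - christoffel g c s l ν y * christoffel g c l s μ y))

/-- The scalar curvature at `x`. -/
def scalarCurvature (g : LorentzMetric M) (x : M) : ℝ :=
  ∑ a : Fin 4, ∑ b : Fin 4, (metricMatrix g x (extChartAt (𝓡 4) x x))⁻¹ a b *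
    ricci g x a b (extChartAt (𝓡 4) x x)

/-- The Klein-Gordon operator `g^{ab} ∇_a ∇_b - m² - ξ R`. -/
def kleinGordon (g : LorentzMetric M) (m ξ : ℝ) (f : M → ℝ) (x : M) : ℝ :=
  box g f x - (m ^ 2 + ξ * scalarCurvature g x) * f x

/-! ### Geodesics, convex normal neighbourhoods and half the squared geodesic distance -/

/-- The geodesic equation for the curve `γ` at the parameter `t`, in the preferred chart at
`γ t`. -/
def GeodesicEqAt (g : LorentzMetric M) (γ : ℝ → M) (t : ℝ) : Prop :=
  let u : ℝ → E4 := fun s ↦ extChartAt (𝓡 4) (γ t) (γ s)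
  ∀ μ : Fin 4, deriv (deriv u) t μ
    + ∑ α : Fin 4, ∑ β : Fin 4,
        christoffel g (γ t) μ α β (u t) * deriv u t α * deriv u t β = 0

/-- The velocity of a curve, as a point of the tangent bundle. -/
def velocity (γ : ℝ → M) (t : ℝ) : TangentBundle (𝓡 4) M :=
  ⟨γ t, mfderiv 𝓘(ℝ, ℝ) (𝓡 4) γ t (1 : ℝ)⟩

/-- There is an affinely parametrised geodesic `γ : [0,1] → D` from `p` to `q` with initial
velocity `v`. -/
def IsGeodesicVelocity (g : LorentzMetric M) (D : Set M) (p q : M) (v : TangentSpace (𝓡 4) p) :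
    Prop :=
  ∃ γ : ℝ → M, (∀ t ∈ Icc (0 : ℝ) 1,
      ContMDiffAt 𝓘(ℝ, ℝ) (𝓡 4) ∞ γ t ∧ γ t ∈ D ∧ GeodesicEqAt g γ t) ∧
    velocity γ 0 = ⟨p, v⟩ ∧ γ 1 = q

open Classical in
/-- The inverse exponential map of `D`: the initial velocity `exp_p⁻¹ q` of the geodesic
`[0,1] → D` from `p` to `q` (`0` if there is none). -/
def logMap (g : LorentzMetric M) (D : Set M) (p q : M) : TangentSpace (𝓡 4) p :=
  if h : ∃ v : TangentSpace (𝓡 4) p, IsGeodesicVelocity g D p q v then h.choose else 0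

/-- Convex normal neighbourhoods: open sets `D` such that any two points of `D` are joined by a
unique geodesic in `D`, and such that these geodesics make `D` a normal neighbourhood of each of
its points (the domain of `exp_p` in `T_p M` is open, and `exp_p⁻¹ q` is smooth in `p, q`). -/
structure IsConvexNormal (g : LorentzMetric M) (D : Set M) : Prop where
  isOpen : IsOpen D
  existsUnique : ∀ p ∈ D, ∀ q ∈ D,
    ∃! v : TangentSpace (𝓡 4) p, IsGeodesicVelocity g D p q v
  isOpen_domain : ∀ p ∈ D,
    IsOpen {v : TangentSpace (𝓡 4) p | ∃ q ∈ D, IsGeodesicVelocity g D p q v}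
  contMDiffOn_log : ContMDiffOn ((𝓡 4).prod (𝓡 4)) (𝓡 4).tangent ∞
    (fun z : M × M ↦ (⟨z.1, logMap g D z.1 z.2⟩ : TangentBundle (𝓡 4) M)) (D ×ˢ D)

/-- Half the squared geodesic distance, `± s(x,x')² / 2`, with the plus sign for spacelike and the
minus sign for timelike separated points. The geodesic `[0,1] → D` from `x'` to `x` has constant
`g(γ', γ')`, so that `s(x,x')² = |g(v, v)|` for its initial velocity `v`. -/
def halfSqDist (g : LorentzMetric M) (D : Set M) (x x' : M) : ℝ :=
  (1 / 2) * g.val x' (logMap g D x' x) (logMap g D x' x)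

/-! ### The Hadamard coefficients -/

/-- The components of `-∇_μ ∇_{ν'} σ (x, x')`, in the preferred charts at `x` and at `x'`. -/
def negMixedDeriv (σ : M → M → ℝ) (x x' : M) : Matrix (Fin 4) (Fin 4) ℝ :=
  Matrix.of fun μ ν ↦
    - pderiv μ (fun y ↦ pderiv ν
        (fun z ↦ σ ((extChartAt (𝓡 4) x).symm y) ((extChartAt (𝓡 4) x').symm z))
        (extChartAt (𝓡 4) x' x')) (extChartAt (𝓡 4) x x)

/-- The van Vleck-Morette determinant. In one oriented chart it is
`-det (-∇_μ ∇_{ν'} σ) / (√(-det g(x)) √(-det g(x')))`, and it is positive; the absolute value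
makes the expression independent of the relative orientation of the charts at `x` and `x'`. -/
def vanVleck (g : LorentzMetric M) (σ : M → M → ℝ) (x x' : M) : ℝ :=
  |(negMixedDeriv σ x x').det| /
    (√(-(metricMatrix g x (extChartAt (𝓡 4) x x)).det) *
      √(-(metricMatrix g x' (extChartAt (𝓡 4) x' x')).det))

/-- The Hadamard coefficient `U`, the square root of the van Vleck-Morette determinant. -/
def hadamardU (g : LorentzMetric M) (D : Set M) (x x' : M) : ℝ :=
  √(vanVleck g (halfSqDist g D) x x')

/-- A bi-scalar of class `C^n` on `D × D`. -/
def BiscalarOn (n : WithTop ℕ∞) (D : Set M) (A : M → M → ℝ) : Prop :=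
  ContMDiffOn ((𝓡 4).prod (𝓡 4)) 𝓘(ℝ, ℝ) n (fun z : M × M ↦ A z.1 z.2) (D ×ˢ D)

/-- The Hadamard recursion relations for the coefficients `V_n` of the Klein-Gordon operator with
mass `m` and curvature coupling `ξ`. -/
structure HadamardRecursion (g : LorentzMetric M) (D : Set M) (m ξ : ℝ)
    (Vn : ℕ → M → M → ℝ) : Prop where
  smooth : ∀ n, BiscalarOn ∞ D (Vn n)
  zero : ∀ x ∈ D, ∀ x' ∈ D,
    2 * gradInner g (fun y ↦ Vn 0 y x') (fun y ↦ halfSqDist g D y x') x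
      + Vn 0 x x' * (box g (fun y ↦ halfSqDist g D y x') x - 2)
      + kleinGordon g m ξ (fun y ↦ hadamardU g D y x') x = 0
  succ : ∀ n : ℕ, ∀ x ∈ D, ∀ x' ∈ D,
    ((n : ℝ) + 1) *
        (2 * gradInner g (fun y ↦ Vn (n + 1) y x') (fun y ↦ halfSqDist g D y x') x
          + Vn (n + 1) x x' * (box g (fun y ↦ halfSqDist g D y x') x + 2 * (n : ℝ)))
      + kleinGordon g m ξ (fun y ↦ Vn n y x') x = 0

/-- `V` is a Hadamard coefficient: a smooth bi-scalar with the asymptotic expansion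
`V ~ ∑ V_n σ^n`, whose coefficients solve the Hadamard recursion relations. -/
def IsHadamardV (g : LorentzMetric M) (D : Set M) (m ξ : ℝ) (V : M → M → ℝ) : Prop :=
  BiscalarOn ∞ D V ∧ ∃ Vn : ℕ → M → M → ℝ, HadamardRecursion g D m ξ Vn ∧
    ∀ N : ℕ, ∃ R : M → M → ℝ, BiscalarOn ∞ D R ∧ ∀ x ∈ D, ∀ x' ∈ D,
      V x x' = ∑ n ∈ Finset.range N, Vn n x x' * halfSqDist g D x x' ^ n
        + R x x' * halfSqDist g D x x' ^ N

/-! ### The Hadamard parametrix and its approximation -/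

/-- `T` is a time function on `D`: it is `C^1` and its gradient is timelike, that is, `dT` does not
vanish on causal vectors. The future is the direction in which `T` increases. -/
def IsTimeFunctionOn (g : LorentzMetric M) (T : M → ℝ) (D : Set M) : Prop :=
  ContMDiffOn (𝓡 4) 𝓘(ℝ, ℝ) 1 T D ∧
    ∀ x ∈ D, ∀ v : TangentSpace (𝓡 4) x, v ≠ 0 → g.val x v v ≤ 0 →
      mfderiv (𝓡 4) 𝓘(ℝ, ℝ) T x v ≠ (0 : ℝ)

/-- The Hadamard expression before the limit `ε → 0+`, from the values `s, u, v` of `σ, U, V` and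
the time difference `τ = T(x) - T(x')`. -/
def hadamardReg (l τ s u v ε : ℝ) : ℂ :=
  1 / (8 * (Real.pi : ℂ) ^ 2) *
    ((u : ℂ) / ((s : ℂ) + 2 * Complex.I * ε * τ + (ε : ℂ) ^ 2)
      + (v : ℂ) * Complex.log (((s : ℂ) + 2 * Complex.I * ε * τ + (ε : ℂ) ^ 2) / (l : ℂ) ^ 2))

/-- The Hadamard parametrix `H^l`, as the limit `ε → 0+` (off the light cone, where it is a
function). -/
def hadamardH (g : LorentzMetric M) (D : Set M) (T : M → ℝ) (l : ℝ) (V : M → M → ℝ)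
    (x x' : M) : ℂ :=
  limUnder (𝓝[>] (0 : ℝ)) fun ε ↦
    hadamardReg l (T x - T x') (halfSqDist g D x x') (hadamardU g D x x') (V x x') ε

/-- The logarithm of a nonzero real number `s`. For `s > 0` it is the real logarithm, and for
`s < 0` the imaginary part is `± π`, the sign being that of the time difference `τ`. -/
def branchLog (τ s : ℝ) : ℂ :=
  (Real.log |s| : ℂ) + if s < 0 then (SignType.sign τ : ℂ) * Real.pi * Complex.I else 0

/-- The approximate Hadamard parametrix
`1 / (2 (2π)²) (Ũ / σ̃ + Ṽ log (σ̃ / l²))`. -/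
def approxH (T : M → ℝ) (l : ℝ) (σ U V : M → M → ℝ) (x x' : M) : ℂ :=
  1 / (2 * (2 * (Real.pi : ℂ)) ^ 2) *
    ((U x x' : ℂ) / (σ x x' : ℂ)
      + (V x x' : ℂ) * branchLog (T x - T x') (σ x x' / l ^ 2))

/-- Off the light cone the limit `ε → 0+` exists, and is given by `branchLog`. -/
theorem tendsto_hadamardReg {l τ s : ℝ} (hl : 0 < l) (hs : s ≠ 0) (hτ : s < 0 → τ ≠ 0) (u v : ℝ) :
    Tendsto (hadamardReg l τ s u v) (𝓝[>] (0 : ℝ)) (𝓝 (1 / (8 * (Real.pi : ℂ) ^ 2) *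
      ((u : ℂ) / (s : ℂ) + (v : ℂ) * branchLog τ (s / l ^ 2)))) := by
  have hl2 : (l : ℂ) ^ 2 ≠ 0 := by exact_mod_cast (pow_pos hl 2).ne'
  have hsC : (s : ℂ) ≠ 0 := by exact_mod_cast hs
  have hz : Tendsto (fun ε : ℝ ↦ (s : ℂ) + 2 * Complex.I * ε * τ + (ε : ℂ) ^ 2) (𝓝[>] 0)
      (𝓝 (s : ℂ)) := by
    have : Continuous (fun ε : ℝ ↦ (s : ℂ) + 2 * Complex.I * ε * τ + (ε : ℂ) ^ 2) := by fun_prop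
    simpa using (this.tendsto 0).mono_left nhdsWithin_le_nhds
  have hw : Tendsto (fun ε : ℝ ↦ ((s : ℂ) + 2 * Complex.I * ε * τ + (ε : ℂ) ^ 2) / (l : ℂ) ^ 2)
      (𝓝[>] 0) (𝓝 ((s / l ^ 2 : ℝ) : ℂ)) := by
    simpa using hz.div_const ((l : ℂ) ^ 2)
  have him : ∀ ε : ℝ, (((s : ℂ) + 2 * Complex.I * ε * τ + (ε : ℂ) ^ 2) / (l : ℂ) ^ 2).im
      = 2 * ε * τ / l ^ 2 := by
    intro ε
    have : ((s : ℂ) + 2 * Complex.I * ε * τ + (ε : ℂ) ^ 2) / (l : ℂ) ^ 2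
        = (((s + ε ^ 2) / l ^ 2 : ℝ) : ℂ) + ((2 * ε * τ / l ^ 2 : ℝ) : ℂ) * Complex.I := by
      push_cast; field_simp; ring
    rw [this]; simp only [Complex.add_im, Complex.ofReal_im, Complex.mul_im, Complex.ofReal_re,
      Complex.I_im, Complex.I_re]; ring
  have hlog : Tendsto (fun ε : ℝ ↦ Complex.log
      (((s : ℂ) + 2 * Complex.I * ε * τ + (ε : ℂ) ^ 2) / (l : ℂ) ^ 2)) (𝓝[>] 0)
      (𝓝 (branchLog τ (s / l ^ 2))) := by
    rcases lt_or_gt_of_ne hs with h | h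
    · have hneg : s / l ^ 2 < 0 := div_neg_of_neg_of_pos h (pow_pos hl 2)
      have hre : ((s / l ^ 2 : ℝ) : ℂ).re < 0 := by rw [Complex.ofReal_re]; exact hneg
      have him0 : ((s / l ^ 2 : ℝ) : ℂ).im = 0 := Complex.ofReal_im _
      rcases lt_or_gt_of_ne (hτ h) with h' | h'
      · have hin : Tendsto (fun ε : ℝ ↦
            ((s : ℂ) + 2 * Complex.I * ε * τ + (ε : ℂ) ^ 2) / (l : ℂ) ^ 2) (𝓝[>] 0)
            (𝓝[{z : ℂ | z.im < 0}] ((s / l ^ 2 : ℝ) : ℂ)) := by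
          refine tendsto_nhdsWithin_iff.2 ⟨hw, ?_⟩
          filter_upwards [self_mem_nhdsWithin] with ε hε
          rw [him]
          exact div_neg_of_neg_of_pos (by have := mem_Ioi.1 hε; nlinarith) (pow_pos hl 2)
        have := (Complex.tendsto_log_nhdsWithin_im_neg_of_re_neg_of_im_zero hre him0).comp hin
        refine this.congr' (Eventually.of_forall fun _ ↦ rfl) |>.trans_eq ?_
        rw [branchLog, if_pos hneg, sign_neg h', Complex.norm_real, Real.norm_eq_abs]
        simp [sub_eq_add_neg]
      · have hin : Tendsto (fun ε : ℝ ↦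
            ((s : ℂ) + 2 * Complex.I * ε * τ + (ε : ℂ) ^ 2) / (l : ℂ) ^ 2) (𝓝[>] 0)
            (𝓝[{z : ℂ | 0 ≤ z.im}] ((s / l ^ 2 : ℝ) : ℂ)) := by
          refine tendsto_nhdsWithin_iff.2 ⟨hw, ?_⟩
          filter_upwards [self_mem_nhdsWithin] with ε hε
          rw [him]
          have := mem_Ioi.1 hε
          positivity
        have := (Complex.tendsto_log_nhdsWithin_im_nonneg_of_re_neg_of_im_zero hre him0).comp hin
        refine this.congr' (Eventually.of_forall fun _ ↦ rfl) |>.trans_eq ?_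
        rw [branchLog, if_pos hneg, sign_pos h', Complex.norm_real, Real.norm_eq_abs]
        simp
    · have hpos : 0 < s / l ^ 2 := div_pos h (pow_pos hl 2)
      have hmem : ((s / l ^ 2 : ℝ) : ℂ) ∈ Complex.slitPlane := Complex.ofReal_mem_slitPlane.2 hpos
      have := (continuousAt_clog hmem).tendsto.comp hw
      rw [branchLog, if_neg hpos.not_gt, add_zero, abs_of_pos hpos, Complex.ofReal_log hpos.le]
      exact this
  exact ((tendsto_const_nhds.div hz hsC).add (hlog.const_mul _)).const_mul _

theorem hadamardH_eq (g : LorentzMetric M) (D : Set M) (T : M → ℝ) {l : ℝ} (hl : 0 < l)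
    (V : M → M → ℝ) {x x' : M} (hs : halfSqDist g D x x' ≠ 0)
    (hτ : halfSqDist g D x x' < 0 → T x ≠ T x') :
    hadamardH g D T l V x x' = 1 / (8 * (Real.pi : ℂ) ^ 2) *
      ((hadamardU g D x x' : ℂ) / (halfSqDist g D x x' : ℂ)
        + (V x x' : ℂ) * branchLog (T x - T x') (halfSqDist g D x x' / l ^ 2)) :=
  (tendsto_hadamardReg hl hs (fun h ↦ sub_ne_zero.2 (hτ h)) _ _).limUnder_eq

/-- Where `σ̃ > 0`, the logarithm in `approxH` is the real one. -/
theorem approxH_of_pos {N : Type*} (T : N → ℝ) {l : ℝ} (hl : 0 < l) (σ U V : N → N → ℝ) {x x' : N}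
    (h : 0 < σ x x') : approxH T l σ U V x x' = ((1 / (2 * (2 * Real.pi) ^ 2) *
      (U x x' / σ x x' + V x x' * Real.log (σ x x' / l ^ 2)) : ℝ) : ℂ) := by
  have hpos : 0 < σ x x' / l ^ 2 := div_pos h (pow_pos hl 2)
  rw [approxH, branchLog, if_neg hpos.not_gt, abs_of_pos hpos]
  push_cast; ring

/-! ### Split-point approximations and coincidence limits -/

/-- `B` is an order-`n` split-point approximation of `A` on `D`: all covariant derivatives, at the
first point, up to order `n` have the same coincidence limits. -/
def IsSplitPointApprox (g : LorentzMetric M) (D : Set M) (n : ℕ) (A B : M → M → ℝ) : Prop :=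
  BiscalarOn n D A ∧ BiscalarOn n D B ∧
    ∀ k ≤ n, ∀ a : Fin k → Fin 4, ∀ x ∈ D, ∃ L : ℝ,
      Tendsto (fun x' ↦ nablaAt g k a (fun y ↦ B y x') x) (𝓝[≠] x) (𝓝 L) ∧
      Tendsto (fun x' ↦ nablaAt g k a (fun y ↦ A y x') x) (𝓝[≠] x) (𝓝 L)

/-- A trajectory ending at `x` (at parameter `0`) with a tangent vector that is not null. -/
def IsNonNullTrajectory (g : LorentzMetric M) (x : M) (γ : ℝ → M) : Prop :=
  γ 0 = x ∧ MDifferentiableAt 𝓘(ℝ, ℝ) (𝓡 4) γ 0 ∧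
    g.val (velocity γ 0).proj (velocity γ 0).snd (velocity γ 0).snd ≠ 0

end Metric

end PointSplitting

end

noncomputable section

namespace PointSplitting

/-! ### Partial derivatives -/

section Pderiv

variable {F : Type*} [NormedAddCommGroup F] [NormedSpace ℝ F]

/-! In the chart at `x`, let `z t` be the coordinates of the trajectory and `v` its velocity. Write
`S, U, V` for the exact quantities and `S', U', V'` for the approximations. Up to the factor `1 / (8
π²)`, the real part of the difference of the two parametrices is `(U - U')/S + U'(S' - S)/(S S') +
(V - V') log S - V' log (1 + (S' - S)/S)` (with `S` inside the first logarithm divided by `l ^ 2`),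
by `hadamardDiff_eq`. Everything is a count of powers of `t`.

The count uses `jetNorm`, in which each derivative carries a factor `|t|`. It is subadditive and
submultiplicative, and the chain rule controls it under inverse and logarithm, so second derivatives
of products and quotients need no separate treatment. A function of jet size `o(t ^ 2)` has second
derivatives `o(1)` and first derivatives `o(t)`, so its second covariant derivatives tend to zero.

Two inputs feed the count. The first is Taylor's theorem near the diagonal. By continuity the
split-point conditions hold on the diagonal itself. Covariant derivatives determine partial ones, so
the differences vanish to the given order at every diagonal point near `(x, x)`. This gives jets
`o(t ^ 6)` for `S' - S` and `o(t ^ 4)` for `U - U'`. For `V - V'` the order is only 2, but `C^3`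
regularity gives `O(t ^ 3)`, which absorbs the logarithm.

The second is the geometry of `S`. The inverse exponential map vanishes on the diagonal and has
differentials `-1` and `1` there in base point and endpoint, so `S(x, z t) / t ^ 2` tends to `g(v,
v) / 2`. This is nonzero because the trajectory is not null. Hence the jet of `1/S` is `O(t ^
(-2))`, that of `log S` is `o(1/t)`, and `S` and `S'` have the same sign.

The imaginary part is a locally constant multiple of `V - V'`. On the timelike side the time
function is strictly monotone to first order along the trajectory, so for fixed small `t` the sign
that selects the branch does not change near `x`. -/

theorem pderiv_congr {f h : E4 → F} {y : E4} (hfh : f =ᶠ[𝓝 y] h) (μ : Fin 4) :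
    pderiv μ f =ᶠ[𝓝 y] pderiv μ h :=
  (hfh.fderiv (𝕜 := ℝ)).mono fun z hz ↦ by simp only [pderiv, hz]

theorem contDiffAt_pderiv {f : E4 → F} {y : E4} {m n : WithTop ℕ∞} (hf : ContDiffAt ℝ n f y)
    (hmn : m + 1 ≤ n) (μ : Fin 4) : ContDiffAt ℝ m (pderiv μ f) y :=
  (hf.fderiv_right hmn).clm_apply contDiffAt_const

theorem pderiv_add {f h : E4 → F} {y : E4} (hf : DifferentiableAt ℝ f y)
    (hh : DifferentiableAt ℝ h y) (μ : Fin 4) :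
    pderiv μ (fun z ↦ f z + h z) y = pderiv μ f y + pderiv μ h y := by
  simp [pderiv, fderiv_fun_add hf hh]

theorem pderiv_sub {f h : E4 → F} {y : E4} (hf : DifferentiableAt ℝ f y)
    (hh : DifferentiableAt ℝ h y) (μ : Fin 4) :
    pderiv μ (fun z ↦ f z - h z) y = pderiv μ f y - pderiv μ h y := by
  simp [pderiv, fderiv_fun_sub hf hh]

theorem pderiv_mul {f h : E4 → ℝ} {y : E4} (hf : DifferentiableAt ℝ f y)
    (hh : DifferentiableAt ℝ h y) (μ : Fin 4) :
    pderiv μ (fun z ↦ f z * h z) y = pderiv μ f y * h y + f y * pderiv μ h y := by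
  simp [pderiv, fderiv_fun_mul hf hh]; ring

theorem pderiv_comp_real {φ : ℝ → ℝ} {f : E4 → ℝ} {y : E4} (hφ : DifferentiableAt ℝ φ (f y))
    (hf : DifferentiableAt ℝ f y) (μ : Fin 4) :
    pderiv μ (fun z ↦ φ (f z)) y = deriv φ (f y) * pderiv μ f y := by
  have := (hφ.hasDerivAt.comp_hasFDerivAt y hf.hasFDerivAt).fderiv
  simp only [pderiv]
  erw [this]
  simp

theorem pderiv_clm_comp {G : Type*} [NormedAddCommGroup G] [NormedSpace ℝ G] (L : F →L[ℝ] G)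
    {f : E4 → F} {y : E4} (hf : DifferentiableAt ℝ f y) (μ : Fin 4) :
    pderiv μ (fun z ↦ L (f z)) y = L (pderiv μ f y) := by
  have := (L.hasFDerivAt.comp y hf.hasFDerivAt).fderiv
  simp only [pderiv]
  erw [this]
  simp

theorem eq_sum_e (v : E4) : v = ∑ ν : Fin 4, v ν • e ν := by
  ext i
  simp [e, Pi.single_apply]

theorem fderiv_eq_sum_pderiv (f : E4 → F) (y v : E4) :
    fderiv ℝ f y v = ∑ ν : Fin 4, v ν • pderiv ν f y := by
  conv_lhs => rw [eq_sum_e v]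
  simp [pderiv]

theorem pderiv_comp {f : E4 → F} {ψ : E4 → E4} {y : E4} (hf : DifferentiableAt ℝ f (ψ y))
    (hψ : DifferentiableAt ℝ ψ y) (μ : Fin 4) :
    pderiv μ (fun z ↦ f (ψ z)) y
      = ∑ ν : Fin 4, pderiv μ (fun z ↦ ψ z ν) y • pderiv ν f (ψ y) := by
  have h1 := (hf.hasFDerivAt.comp y hψ.hasFDerivAt).fderiv
  have h2 : ∀ ν, pderiv μ (fun z ↦ ψ z ν) y = (fderiv ℝ ψ y (e μ)) ν := fun ν ↦
    pderiv_clm_comp (EuclideanSpace.proj ν : E4 →L[ℝ] ℝ) hψ μ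
  simp only [h2]
  rw [← fderiv_eq_sum_pderiv]
  simp only [pderiv]
  erw [h1]
  rfl

theorem norm_fderiv_le_sum_pderiv (f : E4 → F) (y : E4) :
    ‖fderiv ℝ f y‖ ≤ ∑ ν : Fin 4, ‖pderiv ν f y‖ := by
  refine ContinuousLinearMap.opNorm_le_bound _ (Finset.sum_nonneg fun _ _ ↦ norm_nonneg _)
    fun v ↦ ?_
  rw [fderiv_eq_sum_pderiv, Finset.sum_mul]
  refine (norm_sum_le _ _).trans (Finset.sum_le_sum fun ν _ ↦ ?_)
  rw [norm_smul, mul_comm]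
  exact mul_le_mul_of_nonneg_left (PiLp.norm_apply_le v ν) (norm_nonneg _)

end Pderiv

theorem eventually_contDiffAt {E F : Type*} [NormedAddCommGroup E] [NormedSpace ℝ E]
    [NormedAddCommGroup F] [NormedSpace ℝ F] {n : ℕ} {f : E → F} {p : E}
    (hf : ContDiffAt ℝ n f p) : ∀ᶠ y in 𝓝 p, ContDiffAt ℝ n f y :=
  hf.eventually (by simp)

theorem eventually_differentiableAt {E F : Type*} [NormedAddCommGroup E] [NormedSpace ℝ E]
    [NormedAddCommGroup F] [NormedSpace ℝ F] {n : ℕ} {f : E → F} {p : E}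
    (hf : ContDiffAt ℝ ((n + 1 : ℕ) : WithTop ℕ∞) f p) : ∀ᶠ y in 𝓝 p, DifferentiableAt ℝ f y :=
  (eventually_contDiffAt hf).mono fun _ hy ↦ hy.differentiableAt (by simp)

/-! ### Functions that vanish to a given order at a point -/

/-- All partial derivatives of `f` of order at most `n` vanish at `p`. -/
def VanishesToOrder (p : E4) : ℕ → (E4 → ℝ) → Prop
  | 0, f => f p = 0
  | n + 1, f => f p = 0 ∧ ∀ μ, VanishesToOrder p n (pderiv μ f)

namespace VanishesToOrder

variable {p : E4} {n : ℕ} {f h : E4 → ℝ}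

theorem apply_eq_zero (hf : VanishesToOrder p n f) : f p = 0 := by
  cases n with
  | zero => exact hf
  | succ n => exact hf.1

theorem congr (hf : VanishesToOrder p n f) (hfh : f =ᶠ[𝓝 p] h) : VanishesToOrder p n h := by
  induction n generalizing f h with
  | zero => exact hfh.eq_of_nhds.symm.trans hf
  | succ n ih => exact ⟨hfh.eq_of_nhds.symm.trans hf.1, fun μ ↦ ih (hf.2 μ) (pderiv_congr hfh μ)⟩

theorem of_succ (hf : VanishesToOrder p (n + 1) f) : VanishesToOrder p n f := by
  induction n generalizing f with
  | zero => exact hf.1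
  | succ n ih => exact ⟨hf.1, fun μ ↦ ih (hf.2 μ)⟩

theorem zero : VanishesToOrder p n (fun _ ↦ (0 : ℝ)) := by
  induction n with
  | zero => rfl
  | succ n ih =>
    refine ⟨rfl, fun μ ↦ ?_⟩
    have : pderiv μ (fun _ ↦ (0 : ℝ)) = fun _ ↦ 0 := by ext; simp [pderiv]
    rwa [this]

theorem add (hf : VanishesToOrder p n f) (hh : VanishesToOrder p n h)
    (cf : ContDiffAt ℝ n f p) (ch : ContDiffAt ℝ n h p) :
    VanishesToOrder p n (fun y ↦ f y + h y) := by
  induction n generalizing f h with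
  | zero => simp_all [VanishesToOrder]
  | succ n ih =>
    refine ⟨show f p + h p = 0 by rw [hf.1, hh.1, add_zero], fun μ ↦ ?_⟩
    refine (ih (hf.2 μ) (hh.2 μ) (contDiffAt_pderiv cf (by simp) μ)
      (contDiffAt_pderiv ch (by simp) μ)).congr ?_
    filter_upwards [eventually_differentiableAt cf, eventually_differentiableAt ch] with y h1 h2
    rw [pderiv_add h1 h2]

/-- In `∂h · f + h · ∂f` the first summand keeps `f` itself, which vanishes to one order more than
the induction asks; this pays for the derivative that `h` loses. -/
theorem mul_left (hf : VanishesToOrder p n f) (cf : ContDiffAt ℝ n f p)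
    (ch : ContDiffAt ℝ n h p) : VanishesToOrder p n (fun y ↦ h y * f y) := by
  induction n generalizing f h with
  | zero => simp_all [VanishesToOrder]
  | succ n ih =>
    refine ⟨show h p * f p = 0 by rw [hf.1, mul_zero], fun μ ↦ ?_⟩
    have hle : (n : WithTop ℕ∞) ≤ ((n + 1 : ℕ) : WithTop ℕ∞) := by exact_mod_cast n.le_succ
    have ch' := contDiffAt_pderiv (m := n) ch (by simp) μ
    have cf' := contDiffAt_pderiv (m := n) cf (by simp) μ
    refine ((ih hf.of_succ (cf.of_le hle) ch').add (ih (hf.2 μ) cf' (ch.of_le hle))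
      (ch'.mul (cf.of_le hle)) ((ch.of_le hle).mul cf')).congr ?_
    filter_upwards [eventually_differentiableAt cf, eventually_differentiableAt ch] with y h1 h2
    rw [pderiv_mul h2 h1]

theorem sum {ι : Type*} (s : Finset ι) {f : ι → E4 → ℝ} (hf : ∀ i ∈ s, VanishesToOrder p n (f i))
    (cf : ∀ i ∈ s, ContDiffAt ℝ n (f i) p) : VanishesToOrder p n (fun y ↦ ∑ i ∈ s, f i y) := by
  classical
  induction s using Finset.induction_on with
  | empty => simpa using zero
  | insert i s hi ih =>
    simp only [Finset.sum_insert hi]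
    refine (hf i (by simp)).add (ih (fun j hj ↦ hf j (by simp [hj]))
      fun j hj ↦ cf j (by simp [hj])) (cf i (by simp)) ?_
    exact ContDiffAt.sum fun j hj ↦ cf j (by simp [hj])

/-- This makes the order of vanishing independent of the chart: the chain rule writes `∂(f ∘ ψ)` as
a combination of the `(∂_ν f) ∘ ψ`, which vanish to one order less by induction. -/
theorem comp {ψ : E4 → E4} (hf : VanishesToOrder (ψ p) n f) (cf : ContDiffAt ℝ n f (ψ p))
    (cψ : ContDiffAt ℝ n ψ p) : VanishesToOrder p n (fun y ↦ f (ψ y)) := by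
  induction n generalizing f with
  | zero => exact hf
  | succ n ih =>
    refine ⟨hf.1, fun μ ↦ ?_⟩
    have hle : (n : WithTop ℕ∞) ≤ ((n + 1 : ℕ) : WithTop ℕ∞) := by exact_mod_cast n.le_succ
    have c1 : ∀ ν, ContDiffAt ℝ n (pderiv μ fun z ↦ ψ z ν) p := fun ν ↦
      contDiffAt_pderiv (contDiffAt_euclidean.1 cψ ν) (by simp) μ
    have c2 : ∀ ν, ContDiffAt ℝ n (pderiv ν f) (ψ p) := fun ν ↦ contDiffAt_pderiv cf (by simp) ν
    have c3 : ∀ ν, ContDiffAt ℝ n (fun y ↦ pderiv ν f (ψ y)) p := fun ν ↦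
      (c2 ν).comp p (cψ.of_le hle)
    refine (sum Finset.univ (fun ν _ ↦ (ih (hf.2 ν) (c2 ν) (cψ.of_le hle)).mul_left (c3 ν) (c1 ν))
      fun ν _ ↦ (c1 ν).mul (c3 ν)).congr ?_
    filter_upwards [cψ.continuousAt.eventually (eventually_differentiableAt cf),
      eventually_differentiableAt cψ] with y h1 h2
    rw [pderiv_comp h1 h2]
    rfl

end VanishesToOrder

/-! ### Functions of two points near the diagonal -/

/-- The partial derivative of a function of two points with respect to the first point. -/
def pd (μ : Fin 4) (H : E4 × E4 → ℝ) (q : E4 × E4) : ℝ :=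
  pderiv μ (fun y ↦ H (y, q.2)) q.1

theorem pd_eq_fderiv {H : E4 × E4 → ℝ} {q : E4 × E4} (hH : DifferentiableAt ℝ H q) (μ : Fin 4) :
    pd μ H q = fderiv ℝ H q (e μ, 0) := by
  have h1 : HasFDerivAt (fun y : E4 ↦ (y, q.2)) (ContinuousLinearMap.inl ℝ E4 E4) q.1 :=
    hasFDerivAt_prodMk_left q.1 q.2
  have h2 : HasFDerivAt H (fderiv ℝ H q) ((fun y : E4 ↦ (y, q.2)) q.1) := hH.hasFDerivAt
  have := (h2.comp q.1 h1).fderiv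
  simp only [pd, pderiv]
  erw [this]
  simp

theorem contDiffAt_pd {H : E4 × E4 → ℝ} {q : E4 × E4} {n : ℕ}
    (hH : ContDiffAt ℝ ((n + 1 : ℕ) : WithTop ℕ∞) H q) (μ : Fin 4) : ContDiffAt ℝ n (pd μ H) q := by
  have : ContDiffAt ℝ n (fun q ↦ fderiv ℝ H q (e μ, 0)) q :=
    (hH.fderiv_right (by simp)).clm_apply contDiffAt_const
  refine this.congr_of_eventuallyEq ?_
  exact (eventually_differentiableAt hH).mono fun q hq ↦ pd_eq_fderiv hq μ

theorem contDiffAt_left {H : E4 × E4 → ℝ} {y z : E4} {n : WithTop ℕ∞}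
    (hH : ContDiffAt ℝ n H (y, z)) : ContDiffAt ℝ n (fun y ↦ H (y, z)) y :=
  ContDiffAt.comp (f := fun y : E4 ↦ (y, z)) y hH (contDiffAt_id.prodMk contDiffAt_const)

/-- Integration of a bound of the first derivatives near the diagonal. -/
theorem eventually_le_of_pd_le {H : E4 × E4 → ℝ} {x : E4} {n : ℕ} {c : ℝ}
    (hd : ∀ᶠ q in 𝓝 (x, x), DifferentiableAt ℝ H q) (h0 : ∀ᶠ z in 𝓝 x, H (z, z) = 0)
    (hb : ∀ μ, ∀ᶠ q in 𝓝 (x, x), |pd μ H q| ≤ c * ‖q.1 - q.2‖ ^ n) :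
    ∀ᶠ q in 𝓝 (x, x), |H q| ≤ 4 * c * ‖q.1 - q.2‖ ^ (n + 1) := by
  have hall : ∀ᶠ q in 𝓝 (x, x), DifferentiableAt ℝ H q ∧ ∀ μ, |pd μ H q| ≤ c * ‖q.1 - q.2‖ ^ n :=
    hd.and (eventually_all.2 hb)
  obtain ⟨ε, hε, hball⟩ := Metric.eventually_nhds_iff_ball.1 hall
  obtain ⟨δ, hδ, hball'⟩ := Metric.eventually_nhds_iff_ball.1 h0
  refine Metric.eventually_nhds_iff_ball.2 ⟨min ε δ, lt_min hε hδ, ?_⟩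
  rintro ⟨y, z⟩ hq
  rw [← ball_prod_same, mem_prod] at hq
  have hyb : y ∈ Metric.ball x ε := Metric.ball_subset_ball (min_le_left _ _) hq.1
  have hzb : z ∈ Metric.ball x ε := Metric.ball_subset_ball (min_le_left _ _) hq.2
  have hseg : ∀ w ∈ segment ℝ z y, DifferentiableAt ℝ (fun w ↦ H (w, z)) w ∧
      ‖fderiv ℝ (fun w ↦ H (w, z)) w‖ ≤ 4 * c * ‖y - z‖ ^ n := by
    intro w hw
    have hwb : w ∈ Metric.ball x ε := (convex_ball x ε).segment_subset hzb hyb hw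
    obtain ⟨h1, h2⟩ := hball (w, z) (by rw [← ball_prod_same]; exact ⟨hwb, hzb⟩)
    have hwz : ‖w - z‖ ≤ ‖y - z‖ := by
      obtain ⟨θ, hθ, rfl⟩ := segment_eq_image' ℝ z y ▸ hw
      rw [add_sub_cancel_left, norm_smul, Real.norm_eq_abs, abs_of_nonneg hθ.1]
      exact mul_le_of_le_one_left (norm_nonneg _) hθ.2
    refine ⟨h1.comp w (differentiableAt_id.prodMk (differentiableAt_const z)),
      (norm_fderiv_le_sum_pderiv _ _).trans ?_⟩
    have h3 : ∀ μ : Fin 4, ‖pderiv μ (fun w ↦ H (w, z)) w‖ ≤ |c| * ‖y - z‖ ^ n := fun μ ↦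
      ((h2 μ).trans (mul_le_mul_of_nonneg_right (le_abs_self c) (by positivity))).trans
        (mul_le_mul_of_nonneg_left (pow_le_pow_left₀ (norm_nonneg _) hwz n) (abs_nonneg c))
    rcases le_or_gt 0 c with hc | hc
    · rw [abs_of_nonneg hc] at h3
      refine (Finset.sum_le_sum fun μ _ ↦ h3 μ).trans_eq ?_
      simp; ring
    -- No sign is assumed for `c`. A negative one forces both sides of the hypothesis to vanish,
    -- because an absolute value is bounded by a nonpositive number.
    · have hneg : c * ‖w - z‖ ^ n = 0 :=
        le_antisymm (mul_nonpos_of_nonpos_of_nonneg hc.le (by positivity))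
          ((abs_nonneg _).trans (h2 0))
      have hwz0 : w = z ∧ n ≠ 0 := by
        have := (mul_eq_zero.1 hneg).resolve_left hc.ne
        rw [pow_eq_zero_iff'] at this
        exact ⟨sub_eq_zero.1 (norm_eq_zero.1 this.1), this.2⟩
      have hyy := (hball (y, z) (by rw [← ball_prod_same]; exact ⟨hyb, hzb⟩)).2 0
      have hyz : c * ‖y - z‖ ^ n = 0 :=
        le_antisymm (mul_nonpos_of_nonpos_of_nonneg hc.le (by positivity))
          ((abs_nonneg _).trans hyy)
      rw [mul_assoc, hyz, mul_zero]
      refine Finset.sum_nonpos fun μ _ ↦ ?_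
      have h4 := h2 μ
      simp only [hneg] at h4
      exact h4
  have hmv := (convex_segment z y).norm_image_sub_le_of_norm_hasFDerivWithin_le
    (f := fun w ↦ H (w, z)) (f' := fun w ↦ fderiv ℝ (fun w ↦ H (w, z)) w)
    (fun w hw ↦ (hseg w hw).1.hasFDerivAt.hasFDerivWithinAt) (fun w hw ↦ (hseg w hw).2)
    (left_mem_segment ℝ z y) (right_mem_segment ℝ z y)
  have hz0 : H (z, z) = 0 :=
    hball' z (Metric.ball_subset_ball (min_le_right _ _) hq.2)
  simp only [hz0, sub_zero, Real.norm_eq_abs] at hmv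
  rw [pow_succ, ← mul_assoc]
  exact hmv

theorem vanishesToOrder_pd {H : E4 × E4 → ℝ} {x : E4} {n : ℕ}
    (hv : ∀ᶠ z in 𝓝 x, VanishesToOrder z (n + 1) (fun y ↦ H (y, z))) (μ : Fin 4) :
    ∀ᶠ z in 𝓝 x, VanishesToOrder z n (fun y ↦ pd μ H (y, z)) :=
  hv.mono fun _ hz ↦ hz.2 μ

/-- Taylor's theorem with Peano remainder, uniform in the second point. Each induction step
integrates the bound on the first derivatives along the segment from `(z, z)` to `(y, z)` and gains
one power; this is why vanishing is needed on the diagonal near `(x, x)` and not only at that point.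
-/
theorem isLittleO_of_vanishesToOrder {H : E4 × E4 → ℝ} {x : E4} {n : ℕ}
    (hH : ContDiffAt ℝ n H (x, x))
    (hv : ∀ᶠ z in 𝓝 x, VanishesToOrder z n (fun y ↦ H (y, z))) :
    H =o[𝓝 (x, x)] fun q ↦ ‖q.1 - q.2‖ ^ n := by
  induction n generalizing H with
  | zero =>
    simp only [pow_zero]
    rw [Asymptotics.isLittleO_one_iff]
    have := hH.continuousAt.tendsto
    rwa [show H (x, x) = 0 from hv.self_of_nhds.apply_eq_zero] at this
  | succ n ih =>
    refine Asymptotics.isLittleO_iff.2 fun c hc ↦ ?_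
    -- The `4` cancels the factor that the sum over four partial derivatives costs in
    -- `eventually_le_of_pd_le`.
    have hb : ∀ μ, ∀ᶠ q in 𝓝 (x, x), |pd μ H q| ≤ c / 4 * ‖q.1 - q.2‖ ^ n := fun μ ↦ by
      have := Asymptotics.isLittleO_iff.1 (ih (contDiffAt_pd hH μ) (vanishesToOrder_pd hv μ))
        (show 0 < c / 4 by positivity)
      simpa using this
    have := eventually_le_of_pd_le (eventually_differentiableAt hH)
      (hv.mono fun z hz ↦ hz.apply_eq_zero) hb
    filter_upwards [this] with q hq
    rw [Real.norm_eq_abs, Real.norm_of_nonneg (by positivity)]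
    linarith

/-- One derivative beyond the order of vanishing improves `o` of the power `n` to `O` of the power
`n + 1`: the induction now starts from local boundedness of the first derivatives. -/
theorem isBigO_of_vanishesToOrder {H : E4 × E4 → ℝ} {x : E4} {n : ℕ}
    (hH : ContDiffAt ℝ ((n + 1 : ℕ) : WithTop ℕ∞) H (x, x))
    (hv : ∀ᶠ z in 𝓝 x, VanishesToOrder z n (fun y ↦ H (y, z))) :
    H =O[𝓝 (x, x)] fun q ↦ ‖q.1 - q.2‖ ^ (n + 1) := by
  have key : ∃ c, ∀ᶠ q in 𝓝 (x, x), |H q| ≤ c * ‖q.1 - q.2‖ ^ (n + 1) := by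
    induction n generalizing H with
    | zero =>
      -- The constant is the same for all `μ` and strictly exceeds each `|pd μ H (x, x)|`, so by
      -- continuity the bound persists nearby.
      have hb : ∀ μ, ∀ᶠ q in 𝓝 (x, x),
          |pd μ H q| ≤ (1 + ∑ ν, |pd ν H (x, x)|) * ‖q.1 - q.2‖ ^ 0 := fun μ ↦ by
        have hlt : |pd μ H (x, x)| < 1 + ∑ ν, |pd ν H (x, x)| := by
          have := Finset.single_le_sum (f := fun ν ↦ |pd ν H (x, x)|) (fun ν _ ↦ abs_nonneg _)
            (Finset.mem_univ μ)
          linarith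
        have := (contDiffAt_pd (n := 0) hH μ).continuousAt.abs.eventually (gt_mem_nhds hlt)
        filter_upwards [this] with q hq
        simpa using hq.le
      exact ⟨_, eventually_le_of_pd_le (eventually_differentiableAt hH)
        (hv.mono fun z hz ↦ hz.apply_eq_zero) hb⟩
    | succ n ih =>
      choose c hc using fun μ ↦ ih (contDiffAt_pd hH μ) (vanishesToOrder_pd hv μ)
      refine ⟨4 * ∑ μ, |c μ|, eventually_le_of_pd_le (eventually_differentiableAt hH)
        (hv.mono fun z hz ↦ hz.apply_eq_zero) fun μ ↦ ?_⟩
      filter_upwards [hc μ] with q hq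
      refine hq.trans (mul_le_mul_of_nonneg_right ((le_abs_self _).trans ?_) (by positivity))
      exact Finset.single_le_sum (f := fun μ ↦ |c μ|) (fun ν _ ↦ abs_nonneg _) (Finset.mem_univ μ)
  obtain ⟨c, hc⟩ := key
  refine Asymptotics.IsBigO.of_bound c ?_
  filter_upwards [hc] with q hq
  rwa [Real.norm_eq_abs, Real.norm_of_nonneg (by positivity)]

section Manifold

variable {M : Type*} [TopologicalSpace M] [ChartedSpace E4 M] [IsManifold (𝓡 4) ∞ M]

/-! ### Regularity of the metric and of the Christoffel symbols in a chart -/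

theorem contMDiffAt_symm {c : M} {y : E4} (hy : y ∈ (extChartAt (𝓡 4) c).target) :
    ContMDiffAt 𝓘(ℝ, E4) (𝓡 4) ∞ (extChartAt (𝓡 4) c).symm y :=
  (contMDiffOn_extChartAt_symm c).contMDiffAt (extChartAt_target_mem_nhds' hy)

theorem symm_mem_source {c : M} {y : E4} (hy : y ∈ (extChartAt (𝓡 4) c).target) :
    (extChartAt (𝓡 4) c).symm y ∈ (chartAt E4 c).source := by
  rw [← extChartAt_source (𝓡 4)]
  exact (extChartAt (𝓡 4) c).map_target hy

/-- Coordinate vector fields are the constant frame of the tangent bundle trivialization; smoothness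
of the metric coefficients is thereby reduced to smoothness of the metric as a bundle section. -/
theorem mfderiv_symm_eq_symmL {c : M} {y : E4} (hy : y ∈ (extChartAt (𝓡 4) c).target) :
    mfderiv 𝓘(ℝ, E4) (𝓡 4) (extChartAt (𝓡 4) c).symm y =
      (trivializationAt E4 (TangentSpace (𝓡 4)) c).symmL ℝ ((extChartAt (𝓡 4) c).symm y) := by
  have : IsManifold (𝓡 4) 1 M := IsManifold.of_le (n := ∞) (by simp)
  rw [TangentBundle.symmL_trivializationAt (symm_mem_source hy)]
  simp only [modelWithCornersSelf_coe, range_id, mfderivWithin_univ]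
  rw [(extChartAt (𝓡 4) c).right_inv hy]

theorem coordVec_eq {c : M} {y : E4} (hy : y ∈ (extChartAt (𝓡 4) c).target) (μ : Fin 4) :
    coordVec c y μ =
      (trivializationAt E4 (TangentSpace (𝓡 4)) c).symmL ℝ ((extChartAt (𝓡 4) c).symm y) (e μ) := by
  rw [coordVec, mfderiv_symm_eq_symmL hy]
  rfl

theorem mem_baseSet {c : M} {y : E4} (hy : y ∈ (extChartAt (𝓡 4) c).target) :
    (extChartAt (𝓡 4) c).symm y ∈ (trivializationAt E4 (TangentSpace (𝓡 4)) c).baseSet := by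
  rw [TangentBundle.trivializationAt_baseSet]
  exact symm_mem_source hy

theorem contMDiffAt_coordVec {c : M} {y : E4} (hy : y ∈ (extChartAt (𝓡 4) c).target)
    (μ : Fin 4) :
    ContMDiffAt 𝓘(ℝ, E4) (𝓡 4).tangent ∞
      (fun z ↦ (⟨(extChartAt (𝓡 4) c).symm z, coordVec c z μ⟩ : TangentBundle (𝓡 4) M)) y := by
  rw [(trivializationAt E4 (TangentSpace (𝓡 4)) c).contMDiffAt_iff
    ((Trivialization.mem_source _).2 (mem_baseSet hy))]
  refine ⟨contMDiffAt_symm hy, ?_⟩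
  refine (contMDiffAt_const (c := e μ)).congr_of_eventuallyEq ?_
  filter_upwards [extChartAt_target_mem_nhds' hy] with z hz
  rw [coordVec_eq hz, Trivialization.symmL_apply]
  rw [Trivialization.apply_mk_symm]
  all_goals exact mem_baseSet hz

theorem contDiffAt_metricMatrix (g : LorentzMetric M) {c : M} {y : E4}
    (hy : y ∈ (extChartAt (𝓡 4) c).target) (μ ν : Fin 4) :
    ContDiffAt ℝ ∞ (fun z ↦ metricMatrix g c z μ ν) y := by
  have h : ContMDiffAt 𝓘(ℝ, E4) ((𝓡 4).prod 𝓘(ℝ)) ∞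
      (fun z ↦ TotalSpace.mk' ℝ (E := Bundle.Trivial M ℝ) ((extChartAt (𝓡 4) c).symm z)
        (g.val ((extChartAt (𝓡 4) c).symm z) (coordVec c z μ) (coordVec c z ν))) y := by
    apply ContMDiffAt.clm_bundle_apply₂ (F₁ := E4) (F₂ := E4)
    · exact ContMDiffAt.comp y g.contMDiff.contMDiffAt (contMDiffAt_symm hy)
    · exact contMDiffAt_coordVec hy μ
    · exact contMDiffAt_coordVec hy ν
  rw [contMDiffAt_totalSpace] at h
  exact h.2.contDiffAt

theorem coordVec_sum {c : M} {y : E4} (v : E4) :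
    mfderiv 𝓘(ℝ, E4) (𝓡 4) (extChartAt (𝓡 4) c).symm y v = ∑ μ, v μ • coordVec c y μ := by
  conv_lhs => rw [eq_sum_e v]
  simp only [coordVec]
  erw [map_sum]
  exact Finset.sum_congr rfl fun μ _ ↦ map_smul _ _ _

theorem val_mfderiv_symm (g : LorentzMetric M) (c : M) (y v w : E4) :
    g.val ((extChartAt (𝓡 4) c).symm y) (mfderiv 𝓘(ℝ, E4) (𝓡 4) (extChartAt (𝓡 4) c).symm y v)
      (mfderiv 𝓘(ℝ, E4) (𝓡 4) (extChartAt (𝓡 4) c).symm y w)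
      = ∑ μ, ∑ ν, v μ * w ν * metricMatrix g c y μ ν := by
  rw [coordVec_sum, coordVec_sum]
  simp only [map_sum, map_smul, sum_apply, smul_apply,
    metricMatrix, Matrix.of_apply, smul_eq_mul, Finset.mul_sum]
  rw [Finset.sum_comm]
  refine Finset.sum_congr rfl fun μ _ ↦ Finset.sum_congr rfl fun ν _ ↦ by ring

theorem LorentzMetric.eq_zero_of_forall (g : LorentzMetric M) (x : M) (w : TangentSpace (𝓡 4) x)
    (h : ∀ u, g.val x u w = 0) : w = 0 := by
  obtain ⟨b, hb⟩ := g.signature x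
  rw [← b.sum_repr w]
  refine Finset.sum_eq_zero fun i _ ↦ ?_
  have hi := h (b i)
  rw [← b.sum_repr w] at hi
  simp only [map_sum, map_smul, hb, smul_eq_mul] at hi
  simp only [mul_ite, mul_zero, Finset.sum_ite_eq, Finset.mem_univ, if_true] at hi
  have : b.repr w i = 0 := by
    split_ifs at hi <;> simpa using hi
  rw [this, zero_smul]

/-- A kernel vector of the matrix would be orthogonal to all coordinate vectors. These span the
tangent space, so the signature basis forces it to be zero. -/
theorem det_metricMatrix_ne_zero (g : LorentzMetric M) {c : M} {y : E4}
    (hy : y ∈ (extChartAt (𝓡 4) c).target) : (metricMatrix g c y).det ≠ 0 := by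
  intro hdet
  obtain ⟨v, hv, hMv⟩ := Matrix.exists_mulVec_eq_zero_iff.2 hdet
  have hsurj : ∀ u : TangentSpace (𝓡 4) ((extChartAt (𝓡 4) c).symm y), ∃ w : E4,
      mfderiv 𝓘(ℝ, E4) (𝓡 4) (extChartAt (𝓡 4) c).symm y w = u := fun u ↦
    ⟨(trivializationAt E4 (TangentSpace (𝓡 4)) c).continuousLinearMapAt ℝ _ u, by
      rw [mfderiv_symm_eq_symmL hy]
      exact Trivialization.symmL_continuousLinearMapAt _ (mem_baseSet hy) u⟩
  have hzero := g.eq_zero_of_forall ((extChartAt (𝓡 4) c).symm y)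
    (mfderiv 𝓘(ℝ, E4) (𝓡 4) (extChartAt (𝓡 4) c).symm y (WithLp.toLp 2 v)) fun u ↦ by
      obtain ⟨w, rfl⟩ := hsurj u
      rw [val_mfderiv_symm]
      refine Finset.sum_eq_zero fun μ _ ↦ ?_
      have := congrFun hMv μ
      simp only [Matrix.mulVec, dotProduct, Pi.zero_apply] at this
      rw [← mul_zero (w μ), ← this, Finset.mul_sum]
      refine Finset.sum_congr rfl fun ν _ ↦ by ring
  rw [mfderiv_symm_eq_symmL hy] at hzero
  have h2 := Trivialization.continuousLinearMapAt_symmL (R := ℝ)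
    (trivializationAt E4 (TangentSpace (𝓡 4)) c) (mem_baseSet hy) (WithLp.toLp 2 v)
  have h3 : WithLp.toLp 2 v = (0 : E4) :=
    h2.symm.trans ((congrArg _ hzero).trans (map_zero _))
  exact hv (by simpa using congrArg WithLp.ofLp h3)

theorem contDiffAt_metricMatrix_inv (g : LorentzMetric M) {c : M} {y : E4}
    (hy : y ∈ (extChartAt (𝓡 4) c).target) (μ ν : Fin 4) :
    ContDiffAt ℝ ∞ (fun z ↦ (metricMatrix g c z)⁻¹ μ ν) y := by
  have hdet : ∀ A : E4 → Matrix (Fin 4) (Fin 4) ℝ, (∀ i j, ContDiffAt ℝ ∞ (fun z ↦ A z i j) y) →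
      ContDiffAt ℝ ∞ (fun z ↦ (A z).det) y := by
    intro A hA
    simp only [Matrix.det_apply]
    exact ContDiffAt.sum fun σ _ ↦ (contDiffAt_prod fun i _ ↦ hA _ _).const_smul _
  simp only [Matrix.inv_def, Matrix.smul_apply, Ring.inverse_eq_inv', smul_eq_mul]
  refine ((hdet _ (contDiffAt_metricMatrix g hy)).inv (det_metricMatrix_ne_zero g hy)).mul ?_
  simp only [Matrix.adjugate_apply]
  refine hdet _ fun i j ↦ ?_
  simp only [Matrix.updateRow_apply]
  split_ifs
  · exact contDiffAt_const
  · exact contDiffAt_metricMatrix g hy i j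

theorem contDiffAt_christoffel (g : LorentzMetric M) {c : M} {y : E4}
    (hy : y ∈ (extChartAt (𝓡 4) c).target) (l μ ν : Fin 4) :
    ContDiffAt ℝ ∞ (christoffel g c l μ ν) y := by
  have hd : ∀ s i j, ContDiffAt ℝ ∞ (pderiv s fun z ↦ metricMatrix g c z i j) y := fun s i j ↦
    contDiffAt_pderiv (contDiffAt_metricMatrix g hy i j) (by simp) s
  exact contDiffAt_const.mul (ContDiffAt.sum fun s _ ↦ (contDiffAt_metricMatrix_inv g hy l s).mul
    (((hd _ _ _).add (hd _ _ _)).sub (hd _ _ _)))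

/-! ### Iterated covariant derivatives and split-point approximations -/

/-- Regularity is joint in both points, at the cost of one derivative per `∇`; continuity in the
second point is what identifies coincidence limits with values on the diagonal. -/
theorem contDiffAt_covD (g : LorentzMetric M) {c : M} {y z : E4}
    (hy : y ∈ (extChartAt (𝓡 4) c).target) {H : E4 × E4 → ℝ} {k m : ℕ}
    (hH : ContDiffAt ℝ ((m + k : ℕ) : WithTop ℕ∞) H (y, z)) (a : Fin k → Fin 4) :
    ContDiffAt ℝ m (fun q : E4 × E4 ↦ covD g c (fun y ↦ H (y, q.2)) k a q.1) (y, z) := by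
  induction k generalizing m with
  | zero => simpa [covD] using hH
  | succ k ih =>
    have h1 : ∀ b, ContDiffAt ℝ ((m + 1 : ℕ) : WithTop ℕ∞)
        (fun q : E4 × E4 ↦ covD g c (fun y ↦ H (y, q.2)) k b q.1) (y, z) := fun b ↦
      ih (by rwa [add_assoc, add_comm 1 k]) b
    have h2 : ∀ l μ ν, ContDiffAt ℝ m (fun q : E4 × E4 ↦ christoffel g c l μ ν q.1) (y, z) :=
      fun l μ ν ↦ ContDiffAt.comp (g := christoffel g c l μ ν) (y, z)
        ((contDiffAt_christoffel g hy l μ ν).of_le (by exact_mod_cast le_top)) contDiffAt_fst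
    simp only [covD, smul_eq_mul]
    refine (contDiffAt_pd (h1 (Fin.tail a)) (a 0)).sub ?_
    refine ContDiffAt.sum fun i _ ↦ ContDiffAt.sum fun l _ ↦ (h2 _ _ _).mul ?_
    exact (h1 _).of_le (by exact_mod_cast m.le_succ)

theorem contDiffAt_covD_of_contDiffAt (g : LorentzMetric M) {c : M} {y : E4}
    (hy : y ∈ (extChartAt (𝓡 4) c).target) {f : E4 → ℝ} {k m : ℕ}
    (hf : ContDiffAt ℝ ((m + k : ℕ) : WithTop ℕ∞) f y) (a : Fin k → Fin 4) :
    ContDiffAt ℝ m (covD g c f k a) y := by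
  have := contDiffAt_covD g (z := y) hy (H := fun q ↦ f q.1) (k := k) (m := m)
    (hf.comp (y, y) contDiffAt_fst) a
  exact contDiffAt_left this

/-- Two functions with the same covariant derivatives up to order `n` at a point agree there to
order `n`. -/
theorem vanishesToOrder_sub_of_covD_eq (g : LorentzMetric M) {c : M} {y : E4}
    (hy : y ∈ (extChartAt (𝓡 4) c).target) {f h : E4 → ℝ} {n : ℕ}
    (hf : ContDiffAt ℝ n f y) (hh : ContDiffAt ℝ n h y)
    (heq : ∀ k ≤ n, ∀ a : Fin k → Fin 4, covD g c f k a y = covD g c h k a y) :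
    VanishesToOrder y n (fun z ↦ f z - h z) := by
  -- Induction on the order `j` must treat all covariant orders `k` at once, since a partial
  -- derivative of `∇^k` involves `∇^(k+1)`.
  suffices H : ∀ j k : ℕ, k + j ≤ n → ∀ a : Fin k → Fin 4,
      VanishesToOrder y j (fun z ↦ covD g c f k a z - covD g c h k a z) by
    exact H n 0 (by simp) Fin.elim0
  have reg : ∀ {f : E4 → ℝ}, ContDiffAt ℝ n f y → ∀ {j k : ℕ}, k + j ≤ n → ∀ a : Fin k → Fin 4,
      ContDiffAt ℝ j (covD g c f k a) y := fun hf j k hjk a ↦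
    contDiffAt_covD_of_contDiffAt g hy (hf.of_le (by exact_mod_cast (by omega : j + k ≤ n))) a
  intro j
  induction j with
  | zero => exact fun k hk a ↦ sub_eq_zero.2 (heq k (by omega) a)
  | succ j ih =>
    intro k hk a
    refine ⟨sub_eq_zero.2 (heq k (by omega) a), fun μ ↦ ?_⟩
    have hΓ : ∀ l ν ρ, ContDiffAt ℝ j (christoffel g c l ν ρ) y := fun l ν ρ ↦
      (contDiffAt_christoffel g hy l ν ρ).of_le (by exact_mod_cast le_top)
    have hd : ∀ b : Fin k → Fin 4, ContDiffAt ℝ j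
        (fun z ↦ covD g c f k b z - covD g c h k b z) y := fun b ↦
      (reg hf (by omega) b).sub (reg hh (by omega) b)
    have hterm : ∀ (i : Fin k) (l : Fin 4), VanishesToOrder y j (fun z ↦
        christoffel g c l μ (a i) z * (covD g c f k (Function.update a i l) z
          - covD g c h k (Function.update a i l) z)) := fun i l ↦
      (ih k (by omega) _).mul_left (hd _) (hΓ _ _ _)
    have cterm : ∀ (i : Fin k) (l : Fin 4), ContDiffAt ℝ j (fun z ↦
        christoffel g c l μ (a i) z * (covD g c f k (Function.update a i l) z
          - covD g c h k (Function.update a i l) z)) y := fun i l ↦ (hΓ _ _ _).mul (hd _)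
    have hsum := VanishesToOrder.sum Finset.univ
      (fun i _ ↦ VanishesToOrder.sum Finset.univ (fun l _ ↦ hterm i l) fun l _ ↦ cterm i l)
      fun i _ ↦ ContDiffAt.sum fun l _ ↦ cterm i l
    -- The definition of `covD`, solved for the partial derivative: `∂_μ ∇^k = ∇_μ ∇^k + Γ · ∇^k`,
    -- and both terms vanish to order `j`.
    have h1 := ih (k + 1) (by omega) (Fin.cons μ a)
    refine (h1.add hsum ((reg hf (by omega) _).sub (reg hh (by omega) _))
      (ContDiffAt.sum fun i _ ↦ ContDiffAt.sum fun l _ ↦ cterm i l)).congr ?_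
    filter_upwards [eventually_differentiableAt (reg hf (j := j + 1) hk a),
      eventually_differentiableAt (reg hh (j := j + 1) hk a)] with z hz hz'
    rw [pderiv_sub hz hz']
    simp only [covD, Fin.cons_zero, Fin.tail_cons, smul_eq_mul, mul_sub, Finset.sum_sub_distrib]
    ring

/-! ### Bi-scalars in a chart -/

/-- The expression of a bi-scalar in the preferred chart at `c`, for both points. -/
def biChart (c : M) (A : M → M → ℝ) (q : E4 × E4) : ℝ :=
  A ((extChartAt (𝓡 4) c).symm q.1) ((extChartAt (𝓡 4) c).symm q.2)

theorem BiscalarOn.contDiffAt_biChart {n : ℕ} {D : Set M} {A : M → M → ℝ}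
    (hA : BiscalarOn n D A) (hD : IsOpen D) {c : M} {y z : E4}
    (hy : y ∈ (extChartAt (𝓡 4) c).target) (hz : z ∈ (extChartAt (𝓡 4) c).target)
    (hyD : (extChartAt (𝓡 4) c).symm y ∈ D) (hzD : (extChartAt (𝓡 4) c).symm z ∈ D) :
    ContDiffAt ℝ n (biChart c A) (y, z) := by
  have h1 := hA.contMDiffAt ((hD.prod hD).mem_nhds (mk_mem_prod hyD hzD))
  have h2 : ContMDiffAt 𝓘(ℝ, E4 × E4) ((𝓡 4).prod (𝓡 4)) n (fun q : E4 × E4 ↦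
      ((extChartAt (𝓡 4) c).symm q.1, (extChartAt (𝓡 4) c).symm q.2)) (y, z) := by
    have hle : (n : WithTop ℕ∞) ≤ ∞ := by exact_mod_cast le_top
    refine ContMDiffAt.prodMk ?_ ?_
    · exact ((contMDiffAt_symm hy).of_le hle).comp (y, z) contDiffAt_fst.contMDiffAt
    · exact ((contMDiffAt_symm hz).of_le hle).comp (y, z) contDiffAt_snd.contMDiffAt
  exact (h1.comp (y, z) h2).contDiffAt

theorem tendsto_symm_punctured (c : M) :
    Tendsto (extChartAt (𝓡 4) c).symm (𝓝[≠] (extChartAt (𝓡 4) c c)) (𝓝[≠] c) := by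
  refine tendsto_nhdsWithin_iff.2 ⟨?_, ?_⟩
  · have := (continuousAt_extChartAt_symm (I := 𝓡 4) c).tendsto
    rw [extChartAt_to_inv] at this
    exact this.mono_left nhdsWithin_le_nhds
  · filter_upwards [self_mem_nhdsWithin,
      mem_nhdsWithin_of_mem_nhds (extChartAt_target_mem_nhds (I := 𝓡 4) c)] with z hz hzt h
    refine hz ?_
    rw [mem_singleton_iff] at h ⊢
    rw [← (extChartAt (𝓡 4) c).right_inv hzt, h]

/-- The common limit over `x' ≠ p` must equal each value at `x' = p`, because the covariant
derivatives are continuous in `x'`. -/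
theorem IsSplitPointApprox.covD_eq {g : LorentzMetric M} {D : Set M} {n : ℕ} {A B : M → M → ℝ}
    (h : IsSplitPointApprox g D n A B) (hD : IsOpen D) {p : M} (hp : p ∈ D) {k : ℕ} (hk : k ≤ n)
    (a : Fin k → Fin 4) :
    covD g p (fun y ↦ A ((extChartAt (𝓡 4) p).symm y) p) k a (extChartAt (𝓡 4) p p)
      = covD g p (fun y ↦ B ((extChartAt (𝓡 4) p).symm y) p) k a (extChartAt (𝓡 4) p p) := by
  obtain ⟨hA, hB, hlim⟩ := h
  obtain ⟨L, hLB, hLA⟩ := hlim k hk a p hp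
  have key : ∀ {C : M → M → ℝ}, BiscalarOn n D C →
      Tendsto (fun x' ↦ nablaAt g k a (fun y ↦ C y x') p) (𝓝[≠] p) (𝓝 L) →
      covD g p (fun y ↦ C ((extChartAt (𝓡 4) p).symm y) p) k a (extChartAt (𝓡 4) p p) = L := by
    intro C hC hlimC
    have hmem := mem_extChartAt_target (I := 𝓡 4) p
    have hpD : (extChartAt (𝓡 4) p).symm (extChartAt (𝓡 4) p p) ∈ D := by
      rwa [extChartAt_to_inv]
    have hreg := hC.contDiffAt_biChart hD hmem hmem hpD hpD
    have hcov := contDiffAt_covD g (m := 0) (k := k) hmem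
      (hreg.of_le (by exact_mod_cast (by omega : 0 + k ≤ n))) a
    have hcont : ContinuousAt (fun z : E4 ↦ covD g p (fun y ↦ biChart p C (y, z)) k a
        (extChartAt (𝓡 4) p p)) (extChartAt (𝓡 4) p p) :=
      ContinuousAt.comp (f := fun z : E4 ↦ (extChartAt (𝓡 4) p p, z)) hcov.continuousAt
        (by fun_prop)
    have h1 := hcont.tendsto.mono_left (nhdsWithin_le_nhds (s := {extChartAt (𝓡 4) p p}ᶜ))
    have h2 := tendsto_nhds_unique h1 (hlimC.comp (tendsto_symm_punctured p))
    simpa only [biChart, extChartAt_to_inv] using h2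
  rw [key hA hLA, key hB hLB]

/-- The difference between a bi-scalar and a split-point approximation, read in a chart, vanishes
to the order of the approximation on the diagonal. -/
theorem IsSplitPointApprox.vanishesToOrder {g : LorentzMetric M} {D : Set M} {n : ℕ}
    {A B : M → M → ℝ} (h : IsSplitPointApprox g D n A B) (hD : IsOpen D) {c : M} {z : E4}
    (hz : z ∈ (extChartAt (𝓡 4) c).target) (hzD : (extChartAt (𝓡 4) c).symm z ∈ D) :
    VanishesToOrder z n (fun y ↦ biChart c A (y, z) - biChart c B (y, z)) := by
  set p := (extChartAt (𝓡 4) c).symm z with hp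
  have hmem := mem_extChartAt_target (I := 𝓡 4) p
  have hpD : (extChartAt (𝓡 4) p).symm (extChartAt (𝓡 4) p p) ∈ D := by rwa [extChartAt_to_inv]
  have reg : ∀ {C : M → M → ℝ}, BiscalarOn n D C → ContDiffAt ℝ n
      (fun y ↦ C ((extChartAt (𝓡 4) p).symm y) p) (extChartAt (𝓡 4) p p) := by
    intro C hC
    have := contDiffAt_left (hC.contDiffAt_biChart hD hmem hmem hpD hpD)
    simpa only [biChart, extChartAt_to_inv] using this
  have hv := vanishesToOrder_sub_of_covD_eq g hmem (reg h.1) (reg h.2.1)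
    fun k hk a ↦ h.covD_eq hD hzD hk a
  -- The covariant derivatives at `p` are taken in the chart at `p`, while the claim concerns the
  -- fixed chart at `c`; the transition map carries the order of vanishing across.
  have hψ : ContDiffAt ℝ n (fun y ↦ extChartAt (𝓡 4) p ((extChartAt (𝓡 4) c).symm y)) z := by
    have h1 : ContMDiffAt (𝓡 4) 𝓘(ℝ, E4) ∞ (extChartAt (𝓡 4) p) p := contMDiffAt_extChartAt
    exact ((h1.comp z (contMDiffAt_symm hz)).contDiffAt).of_le (by exact_mod_cast le_top)
  refine (VanishesToOrder.comp
    (ψ := fun y ↦ extChartAt (𝓡 4) p ((extChartAt (𝓡 4) c).symm y)) hv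
    ((reg h.1).sub (reg h.2.1)) hψ).congr ?_
  have hnear : ∀ᶠ y in 𝓝 z, (extChartAt (𝓡 4) c).symm y ∈ (extChartAt (𝓡 4) p).source :=
    (contMDiffAt_symm hz).continuousAt.eventually (extChartAt_source_mem_nhds p)
  filter_upwards [hnear] with y hy
  simp only [biChart, (extChartAt (𝓡 4) p).left_inv hy, ← hp]

/-! ### Geodesics and the inverse exponential map -/

theorem IsConvexNormal.logMap_eq {g : LorentzMetric M} {D : Set M} (hD : IsConvexNormal g D)
    {p q : M} (hp : p ∈ D) (hq : q ∈ D) {v : TangentSpace (𝓡 4) p}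
    (hv : IsGeodesicVelocity g D p q v) : logMap g D p q = v := by
  have h : ∃ v : TangentSpace (𝓡 4) p, IsGeodesicVelocity g D p q v := ⟨v, hv⟩
  rw [logMap, dif_pos h]
  exact (hD.existsUnique p hp q hq).unique h.choose_spec hv

theorem isGeodesicVelocity_zero (g : LorentzMetric M) {D : Set M} {p : M} (hp : p ∈ D) :
    IsGeodesicVelocity g D p p 0 := by
  refine ⟨fun _ ↦ p, fun t _ ↦ ⟨contMDiffAt_const, hp, fun μ ↦ ?_⟩, ?_, rfl⟩
  · simp
  · simp only [velocity, mfderiv_const]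
    rfl

/-- Both terms of the geodesic equation are homogeneous of degree two in `s`. The rescaling rules
for `deriv` need no differentiability and include `s = 0`. -/
theorem GeodesicEqAt.comp_mul {g : LorentzMetric M} {γ : ℝ → M} {s t : ℝ}
    (h : GeodesicEqAt g γ (s * t)) : GeodesicEqAt g (fun r ↦ γ (s * r)) t := by
  intro μ
  let w : ℝ → E4 := fun r ↦ extChartAt (𝓡 4) (γ (s * t)) (γ r)
  let u : ℝ → E4 := fun r ↦ w (s * r)
  have h1 : deriv (deriv w) (s * t) μ + ∑ α, ∑ β, christoffel g (γ (s * t)) μ α β (w (s * t)) *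
      deriv w (s * t) α * deriv w (s * t) β = 0 := h μ
  change deriv (deriv u) t μ + ∑ α, ∑ β, christoffel g (γ (s * t)) μ α β (w (s * t)) *
      deriv u t α * deriv u t β = 0
  have hu : u = fun r ↦ w (s * r) := rfl
  have hd : deriv u = fun r ↦ s • deriv w (s * r) := by
    funext r
    rw [hu, deriv_comp_mul_left]
  have hdd : deriv (deriv u) t = s • s • deriv (deriv w) (s * t) := by
    rw [hd]
    have h2 : (fun r ↦ s • deriv w (s * r)) = s • fun r ↦ deriv w (s * r) := rfl
    rw [h2, deriv_const_smul_field, deriv_comp_mul_left]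
  rw [hdd, hd]
  simp only [PiLp.smul_apply, smul_eq_mul]
  calc _ = s * s * (deriv (deriv w) (s * t) μ + ∑ α, ∑ β,
        christoffel g (γ (s * t)) μ α β (w (s * t)) * deriv w (s * t) α * deriv w (s * t) β) := by
        rw [mul_add, Finset.mul_sum]
        congr 1
        · ring
        · refine Finset.sum_congr rfl fun α _ ↦ ?_
          rw [Finset.mul_sum]
          refine Finset.sum_congr rfl fun β _ ↦ by ring
    _ = 0 := by rw [h1, mul_zero]

/-- With uniqueness this says that the inverse exponential map at `γ 0` is linear along the
geodesic: it sends `γ s` to `s` times the initial velocity. -/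
theorem isGeodesicVelocity_smul {g : LorentzMetric M} {D : Set M} {γ : ℝ → M}
    (hγ : ∀ t ∈ Icc (0 : ℝ) 1,
      ContMDiffAt 𝓘(ℝ, ℝ) (𝓡 4) ∞ γ t ∧ γ t ∈ D ∧ GeodesicEqAt g γ t)
    {s : ℝ} (hs : s ∈ Icc (0 : ℝ) 1) :
    IsGeodesicVelocity g D (γ 0) (γ s) (s • mfderiv 𝓘(ℝ, ℝ) (𝓡 4) γ 0 (1 : ℝ)) := by
  have hmem : ∀ t ∈ Icc (0 : ℝ) 1, s * t ∈ Icc (0 : ℝ) 1 := fun t ht ↦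
    ⟨mul_nonneg hs.1 ht.1, mul_le_one₀ hs.2 ht.1 ht.2⟩
  refine ⟨fun t ↦ γ (s * t), fun t ht ↦ ?_, ?_, by simp⟩
  · obtain ⟨h1, h2, h3⟩ := hγ _ (hmem t ht)
    have h4 : ContMDiffAt 𝓘(ℝ, ℝ) 𝓘(ℝ, ℝ) ∞ (fun t : ℝ ↦ s * t) t :=
      (contDiffAt_const.mul contDiffAt_id).contMDiffAt
    exact ⟨ContMDiffAt.comp (f := fun t : ℝ ↦ s * t) t h1 h4, h2, h3.comp_mul⟩
  · have h0 : MDifferentiableAt 𝓘(ℝ, ℝ) (𝓡 4) γ (s * 0) := by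
      rw [mul_zero]
      exact (hγ 0 (by simp)).1.mdifferentiableAt (by simp)
    have hd : HasFDerivAt (fun t : ℝ ↦ s * t) (s • ContinuousLinearMap.id ℝ ℝ) 0 :=
      (hasFDerivAt_id 0).const_mul s
    have h1 := (h0.hasMFDerivAt.comp (0 : ℝ) (f := fun t : ℝ ↦ s * t) hd.hasMFDerivAt).mfderiv
    -- The fibre containing the velocity depends on the parameter, so `s * 0` is generalized to `r`
    -- before it is replaced by `0`.
    have h2 : ∀ r : ℝ, r = 0 →
        (⟨γ r, mfderiv 𝓘(ℝ, ℝ) (𝓡 4) γ r (s : ℝ)⟩ : TangentBundle (𝓡 4) M) =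
        ⟨γ 0, s • mfderiv 𝓘(ℝ, ℝ) (𝓡 4) γ 0 (1 : ℝ)⟩ := by
      rintro r rfl
      congr 1
      have h3 : ∀ L : ℝ →L[ℝ] E4, L s = s • L 1 := fun L ↦ by rw [← L.map_smul]; simp
      exact h3 _
    rw [velocity, ← h2 (s * 0) (mul_zero s)]
    change (⟨γ (s * 0), mfderiv 𝓘(ℝ, ℝ) (𝓡 4) (γ ∘ fun t : ℝ ↦ s * t) 0 (1 : ℝ)⟩ :
      TangentBundle (𝓡 4) M) = _
    rw [h1]
    congr 1
    change mfderiv 𝓘(ℝ, ℝ) (𝓡 4) γ (s * 0) ((s • ContinuousLinearMap.id ℝ ℝ) 1) = _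
    simp

/-- The inverse exponential map in the preferred chart at `c`. -/
def logChart (g : LorentzMetric M) (D : Set M) (c : M) (q : E4 × E4) : E4 :=
  (trivializationAt E4 (TangentSpace (𝓡 4)) c
    ⟨(extChartAt (𝓡 4) c).symm q.1,
      logMap g D ((extChartAt (𝓡 4) c).symm q.1) ((extChartAt (𝓡 4) c).symm q.2)⟩).2

theorem trivializationAt_self_snd (x : M) (v : TangentSpace (𝓡 4) x) :
    (trivializationAt E4 (TangentSpace (𝓡 4)) x ⟨x, v⟩).2 = v :=
  congrArg Prod.snd ((tangentBundleCore (𝓡 4) M).toFiberBundleCore.localTrivAt_apply_mk x v)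

theorem trivializationAt_snd {c p : M} (hp : p ∈ (trivializationAt E4 (TangentSpace (𝓡 4)) c).baseSet)
    (v : TangentSpace (𝓡 4) p) :
    (trivializationAt E4 (TangentSpace (𝓡 4)) c ⟨p, v⟩).2 =
      (trivializationAt E4 (TangentSpace (𝓡 4)) c).continuousLinearMapAt ℝ p v := by
  rw [Trivialization.continuousLinearMapAt_apply, Trivialization.coe_linearMapAt_of_mem _ hp]

theorem metricMatrix_self (g : LorentzMetric M) (x : M) (v : E4) :
    ∑ μ, ∑ ν, v μ * v ν * metricMatrix g x (extChartAt (𝓡 4) x x) μ ν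
      = g.val x v v := by
  rw [← val_mfderiv_symm, mfderiv_symm_eq_symmL (mem_extChartAt_target x)]
  have h : ∀ p : M, p = x →
      g.val p ((trivializationAt E4 (TangentSpace (𝓡 4)) x).symmL ℝ p v)
        ((trivializationAt E4 (TangentSpace (𝓡 4)) x).symmL ℝ p v) = g.val x v v := by
    rintro p rfl
    have h1 : (trivializationAt E4 (TangentSpace (𝓡 4)) p).symmL ℝ p v = v := by
      have hb : p ∈ (trivializationAt E4 (TangentSpace (𝓡 4)) p).baseSet :=
        FiberBundle.mem_baseSet_trivializationAt' p
      have h2 := Trivialization.symmL_continuousLinearMapAt (R := ℝ)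
        (trivializationAt E4 (TangentSpace (𝓡 4)) p) hb v
      exact (congrArg _ ((trivializationAt_snd hb v).symm.trans
        (trivializationAt_self_snd p v))).symm.trans h2
    rw [h1]
  exact h _ (extChartAt_to_inv x)

section Log

variable {g : LorentzMetric M} {D : Set M}

theorem IsConvexNormal.contDiffAt_logChart (hD : IsConvexNormal g D) {x : M} (hx : x ∈ D) :
    ContDiffAt ℝ ∞ (logChart g D x) (extChartAt (𝓡 4) x x, extChartAt (𝓡 4) x x) := by
  have hmem := mem_extChartAt_target (I := 𝓡 4) x
  have hxD : (extChartAt (𝓡 4) x).symm (extChartAt (𝓡 4) x x) ∈ D := by rwa [extChartAt_to_inv]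
  have h1 := hD.contMDiffOn_log.contMDiffAt
    ((hD.isOpen.prod hD.isOpen).mem_nhds (mk_mem_prod hxD hxD))
  have h2 : ContMDiffAt 𝓘(ℝ, E4 × E4) ((𝓡 4).prod (𝓡 4)) ∞ (fun q : E4 × E4 ↦
      ((extChartAt (𝓡 4) x).symm q.1, (extChartAt (𝓡 4) x).symm q.2))
      (extChartAt (𝓡 4) x x, extChartAt (𝓡 4) x x) :=
    ContMDiffAt.prodMk
      ((contMDiffAt_symm hmem).comp (_, _) contDiffAt_fst.contMDiffAt)
      ((contMDiffAt_symm hmem).comp (_, _) contDiffAt_snd.contMDiffAt)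
  have h3 := h1.comp (_, _) h2
  rw [(trivializationAt E4 (TangentSpace (𝓡 4)) x).contMDiffAt_iff
    ((Trivialization.mem_source _).2 (mem_baseSet hmem))] at h3
  exact h3.2.contDiffAt

theorem IsConvexNormal.logChart_self (hD : IsConvexNormal g D) {c : M} {y : E4}
    (hy : y ∈ (extChartAt (𝓡 4) c).target) (hyD : (extChartAt (𝓡 4) c).symm y ∈ D) :
    logChart g D c (y, y) = 0 := by
  rw [logChart, hD.logMap_eq hyD hyD (isGeodesicVelocity_zero g hyD),
    trivializationAt_snd (mem_baseSet hy), map_zero]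

theorem halfSqDist_eq_logChart {c : M} {y z : E4} (hz : z ∈ (extChartAt (𝓡 4) c).target) :
    biChart c (halfSqDist g D) (y, z) = 1 / 2 * ∑ μ, ∑ ν,
      logChart g D c (z, y) μ * logChart g D c (z, y) ν * metricMatrix g c z μ ν := by
  have key : mfderiv 𝓘(ℝ, E4) (𝓡 4) (extChartAt (𝓡 4) c).symm z (logChart g D c (z, y))
      = logMap g D ((extChartAt (𝓡 4) c).symm z) ((extChartAt (𝓡 4) c).symm y) := by
    rw [mfderiv_symm_eq_symmL hz, logChart, trivializationAt_snd (mem_baseSet hz)]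
    exact Trivialization.symmL_continuousLinearMapAt _ (mem_baseSet hz) _
  rw [← val_mfderiv_symm, key]
  rfl

theorem hasDerivAt_extChartAt_comp {x : M} {γ : ℝ → M} (h0 : γ 0 = x)
    (hγ : MDifferentiableAt 𝓘(ℝ, ℝ) (𝓡 4) γ 0) {v : E4}
    (hv : mfderiv 𝓘(ℝ, ℝ) (𝓡 4) γ 0 (1 : ℝ) = v) :
    HasDerivAt (fun t ↦ extChartAt (𝓡 4) x (γ t)) v 0 := by
  subst h0
  have h := hγ.hasMFDerivAt.2
  obtain ⟨L, hL⟩ : ∃ L : ℝ →L[ℝ] E4, L = mfderiv 𝓘(ℝ, ℝ) (𝓡 4) γ 0 := ⟨_, rfl⟩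
  rw [← hL] at h hv
  simp only [mfld_simps] at h
  have h' : HasFDerivWithinAt (fun t ↦ extChartAt (𝓡 4) (γ 0) (γ t)) L univ (0 : ℝ) := h
  have hv' : L 1 = v := hv
  rw [← hv']
  exact (hasFDerivWithinAt_univ.1 h').hasDerivAt

/-- Differentiating `log_x (γ t) = t • w` along the geodesic with initial velocity `w` gives `A (0,
w) = w` for every velocity `w` of a geodesic in `D` from `x`; linearity extends this to all vectors.
-/
theorem IsConvexNormal.fderiv_logChart_right (hD : IsConvexNormal g D) {x : M} (hx : x ∈ D)
    (v : E4) :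
    fderiv ℝ (logChart g D x) (extChartAt (𝓡 4) x x, extChartAt (𝓡 4) x x) (0, v) = v := by
  set x₀ := extChartAt (𝓡 4) x x with hx₀
  set A := fderiv ℝ (logChart g D x) (x₀, x₀) with hA
  have hdiff : HasFDerivAt (logChart g D x) A (x₀, x₀) :=
    ((hD.contDiffAt_logChart hx).differentiableAt (by simp)).hasFDerivAt
  have key : ∀ w : E4, (∃ q ∈ D, IsGeodesicVelocity g D x q w) → A (0, w) = w := by
    rintro w ⟨q, hq, γ, hγ, hvel, rfl⟩
    have h0 : γ 0 = x := congrArg TotalSpace.proj hvel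
    subst h0
    have hw : mfderiv 𝓘(ℝ, ℝ) (𝓡 4) γ 0 (1 : ℝ) = w := TotalSpace.mk_inj.1 hvel
    have hmd : MDifferentiableAt 𝓘(ℝ, ℝ) (𝓡 4) γ 0 :=
      (hγ 0 (by simp)).1.mdifferentiableAt (by simp)
    have hz := hasDerivAt_extChartAt_comp rfl hmd hw
    have h1 : HasDerivAt (fun t ↦ logChart g D (γ 0) (x₀, extChartAt (𝓡 4) (γ 0) (γ t)))
        (A (0, w)) 0 :=
      HasFDerivAt.comp_hasDerivAt (l := logChart g D (γ 0)) (l' := A) (0 : ℝ)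
        (f := fun t ↦ (x₀, extChartAt (𝓡 4) (γ 0) (γ t))) (by simpa only [hx₀] using hdiff) ((hasDerivAt_const (0 : ℝ) x₀).prodMk hz)
    have h2 : HasDerivAt (fun t : ℝ ↦ t • w) w 0 := by
      simpa using (hasDerivAt_id (0 : ℝ)).smul_const w
    have hsrc : ∀ᶠ t in 𝓝 (0 : ℝ), γ t ∈ (extChartAt (𝓡 4) (γ 0)).source :=
      hmd.continuousAt.eventually (extChartAt_source_mem_nhds (γ 0))
    -- The geodesic is controlled only on `[0, 1]`, so the two curves are compared from the right; a
    -- one-sided derivative suffices since both are differentiable.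
    have heq : (fun t ↦ logChart g D (γ 0) (x₀, extChartAt (𝓡 4) (γ 0) (γ t))) =ᶠ[𝓝[≥] 0]
        fun t : ℝ ↦ t • w := by
      filter_upwards [self_mem_nhdsWithin, mem_nhdsWithin_of_mem_nhds (Iic_mem_nhds one_pos),
        mem_nhdsWithin_of_mem_nhds hsrc] with t ht ht1 hts
      have hst : t ∈ Icc (0 : ℝ) 1 := ⟨ht, ht1⟩
      have hlog := hD.logMap_eq hx (hγ t hst).2.1 (isGeodesicVelocity_smul hγ hst)
      have hgen : ∀ p : M, p = γ 0 → (trivializationAt E4 (TangentSpace (𝓡 4)) (γ 0)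
          ⟨p, logMap g D p (γ t)⟩).2 = t • w := by
        rintro p rfl
        rw [hlog, trivializationAt_self_snd, hw]
        rfl
      have := hgen _ (extChartAt_to_inv (I := 𝓡 4) (γ 0))
      simpa only [logChart, (extChartAt (𝓡 4) (γ 0)).left_inv hts] using this
    exact (uniqueDiffWithinAt_Ici (0 : ℝ)).eq_deriv _ h1.hasDerivWithinAt
      (h2.hasDerivWithinAt.congr_of_eventuallyEq heq (heq.eq_of_nhdsWithin self_mem_Ici))
  -- The set of geodesic velocities is open and contains zero, so it contains a nonzero multiple of
  -- any `v`.
  have hopen : {w : E4 | ∃ q ∈ D, IsGeodesicVelocity g D x q (w : TangentSpace (𝓡 4) x)} ∈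
      𝓝 (0 : E4) := (hD.isOpen_domain x hx).mem_nhds ⟨x, hx, isGeodesicVelocity_zero g hx⟩
  have hlim : Tendsto (fun r : ℝ ↦ r • v) (𝓝[≠] 0) (𝓝 0) := by
    have : Continuous fun r : ℝ ↦ r • v := by fun_prop
    simpa using (this.tendsto 0).mono_left nhdsWithin_le_nhds
  obtain ⟨r, hr, hr0⟩ := ((hlim.eventually hopen).and self_mem_nhdsWithin).exists
  have h3 : A (0, r • v) = r • v := key _ hr
  have h4 : ((0, r • v) : E4 × E4) = r • (0, v) := by simp
  rw [h4, map_smul] at h3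
  exact smul_right_injective E4 hr0 h3

/-- The map vanishes on the diagonal, so its differential kills `(v, v) = (v, 0) + (0, v)`. -/
theorem IsConvexNormal.fderiv_logChart_left (hD : IsConvexNormal g D) {x : M} (hx : x ∈ D)
    (v : E4) :
    fderiv ℝ (logChart g D x) (extChartAt (𝓡 4) x x, extChartAt (𝓡 4) x x) (v, 0) = -v := by
  set x₀ := extChartAt (𝓡 4) x x with hx₀
  have hdiff : HasFDerivAt (logChart g D x) (fderiv ℝ (logChart g D x) (x₀, x₀)) (x₀, x₀) :=
    ((hD.contDiffAt_logChart hx).differentiableAt (by simp)).hasFDerivAt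
  have h1 : HasFDerivAt (fun y : E4 ↦ logChart g D x (y, y)) _ x₀ :=
    HasFDerivAt.comp (f := fun y : E4 ↦ (y, y)) x₀ hdiff
      ((hasFDerivAt_id x₀).prodMk (hasFDerivAt_id x₀))
  have h2 : (fun y : E4 ↦ logChart g D x (y, y)) =ᶠ[𝓝 x₀] fun _ ↦ 0 := by
    have hDn : ∀ᶠ y in 𝓝 x₀, (extChartAt (𝓡 4) x).symm y ∈ D :=
      (continuousAt_extChartAt_symm x).eventually
        (hD.isOpen.mem_nhds (by rwa [extChartAt_to_inv]))
    filter_upwards [extChartAt_target_mem_nhds (I := 𝓡 4) x, hDn] with y hy hyD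
    exact hD.logChart_self hy hyD
  have h3 := h1.unique ((hasFDerivAt_const (0 : E4) x₀).congr_of_eventuallyEq h2)
  have h4 := DFunLike.congr_fun h3 v
  have h5 : fderiv ℝ (logChart g D x) (x₀, x₀) (v, v) = 0 := h4
  have h6 : ((v, v) : E4 × E4) = (v, 0) + (0, v) := by simp
  rw [h6, map_add, hD.fderiv_logChart_right hx] at h5
  exact eq_neg_of_add_eq_zero_left h5

/-- Half the squared distance along a curve through `x`, to second order. -/
theorem IsConvexNormal.tendsto_halfSqDist_div_sq (hD : IsConvexNormal g D) {x : M} (hx : x ∈ D)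
    {z : ℝ → E4} {v : E4} (hz0 : z 0 = extChartAt (𝓡 4) x x)
    (hz : HasDerivAt z v 0) :
    Tendsto (fun t ↦ biChart x (halfSqDist g D) (extChartAt (𝓡 4) x x, z t) / t ^ 2) (𝓝[≠] 0)
      (𝓝 (1 / 2 * g.val x v v)) := by
  set x₀ := extChartAt (𝓡 4) x x with hx₀
  have hmem : x₀ ∈ (extChartAt (𝓡 4) x).target := mem_extChartAt_target x
  have hdiff : HasFDerivAt (logChart g D x) (fderiv ℝ (logChart g D x) (x₀, x₀)) (z 0, x₀) := by
    rw [hz0]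
    exact ((hD.contDiffAt_logChart hx).differentiableAt (by simp)).hasFDerivAt
  -- The second argument of `halfSqDist` is the base point of the inverse exponential map, so the
  -- trajectory moves the base point; the resulting sign disappears in the quadratic form.
  have h1 : HasDerivAt (fun t ↦ logChart g D x (z t, x₀)) (-v) 0 := by
    rw [← hD.fderiv_logChart_left hx]
    exact HasFDerivAt.comp_hasDerivAt (0 : ℝ) (f := fun t ↦ (z t, x₀)) hdiff
      (hz.prodMk (hasDerivAt_const (0 : ℝ) x₀))
  have hself : logChart g D x (x₀, x₀) = 0 :=
    hD.logChart_self hmem (by rwa [extChartAt_to_inv])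
  have h2 : Tendsto (fun t ↦ t⁻¹ • logChart g D x (z t, x₀)) (𝓝[≠] 0) (𝓝 (-v)) := by
    have := hasDerivAt_iff_tendsto_slope_zero.1 h1
    simpa [hz0, hself] using this
  have h2' : ∀ μ, Tendsto (fun t ↦ t⁻¹ * logChart g D x (z t, x₀) μ) (𝓝[≠] 0)
      (𝓝 (-v μ)) := fun μ ↦
    ((EuclideanSpace.proj μ : E4 →L[ℝ] ℝ).continuous.tendsto _).comp h2
  have h3 : ∀ μ ν, Tendsto (fun t ↦ metricMatrix g x (z t) μ ν) (𝓝[≠] 0)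
      (𝓝 (metricMatrix g x x₀ μ ν)) := fun μ ν ↦ by
    have h4 : Tendsto z (𝓝[≠] 0) (𝓝 x₀) := by
      rw [← hz0]
      exact hz.continuousAt.tendsto.mono_left nhdsWithin_le_nhds
    exact (contDiffAt_metricMatrix g hmem μ ν).continuousAt.tendsto.comp h4
  have h4 : Tendsto (fun t ↦ 1 / 2 * ∑ μ, ∑ ν, (t⁻¹ * logChart g D x (z t, x₀) μ) *
      (t⁻¹ * logChart g D x (z t, x₀) ν) * metricMatrix g x (z t) μ ν) (𝓝[≠] 0)
      (𝓝 (1 / 2 * ∑ μ, ∑ ν, (-v μ) * (-v ν) * metricMatrix g x x₀ μ ν)) :=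
    (tendsto_finsetSum _ fun μ _ ↦ tendsto_finsetSum _ fun ν _ ↦
      ((h2' μ).mul (h2' ν)).mul (h3 μ ν)).const_mul _
  simp only [neg_mul_neg] at h4
  rw [hx₀, metricMatrix_self] at h4
  refine h4.congr' ?_
  have htar : ∀ᶠ t in 𝓝[≠] (0 : ℝ), z t ∈ (extChartAt (𝓡 4) x).target := by
    refine (hz.continuousAt.tendsto.mono_left nhdsWithin_le_nhds).eventually ?_
    rw [hz0]
    exact extChartAt_target_mem_nhds x
  filter_upwards [htar, self_mem_nhdsWithin] with t ht ht0
  rw [halfSqDist_eq_logChart ht, mul_div_assoc, Finset.sum_div]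
  refine congrArg _ (Finset.sum_congr rfl fun μ _ ↦ ?_)
  rw [Finset.sum_div]
  refine Finset.sum_congr rfl fun ν _ ↦ ?_
  have ht0' : t ≠ 0 := ht0
  rw [← hx₀]
  field_simp

/-- With the base point fixed, half the squared distance is a constant quadratic form in a map that
vanishes at `x`. -/
theorem IsConvexNormal.pd_halfSqDist_self (hD : IsConvexNormal g D) {x : M} (hx : x ∈ D)
    (μ : Fin 4) :
    pd μ (biChart x (halfSqDist g D)) (extChartAt (𝓡 4) x x, extChartAt (𝓡 4) x x) = 0 := by
  set x₀ := extChartAt (𝓡 4) x x with hx₀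
  have hmem : x₀ ∈ (extChartAt (𝓡 4) x).target := mem_extChartAt_target x
  have hL : ∀ i, DifferentiableAt ℝ (fun y ↦ logChart g D x (x₀, y) i) x₀ := fun i ↦ by
    have h1 : DifferentiableAt ℝ (fun y ↦ logChart g D x (x₀, y)) x₀ :=
      DifferentiableAt.comp (f := fun y : E4 ↦ (x₀, y)) x₀
        ((hD.contDiffAt_logChart hx).differentiableAt (by simp))
        ((differentiableAt_const x₀).prodMk differentiableAt_id)
    exact (EuclideanSpace.proj i : E4 →L[ℝ] ℝ).differentiableAt.comp x₀ h1
  have hself : logChart g D x (x₀, x₀) = 0 :=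
    hD.logChart_self hmem (by rwa [extChartAt_to_inv])
  have hterm : ∀ i j, HasFDerivAt (fun y ↦ logChart g D x (x₀, y) i * logChart g D x (x₀, y) j *
      metricMatrix g x x₀ i j) (0 : E4 →L[ℝ] ℝ) x₀ := fun i j ↦ by
    have := ((hL i).hasFDerivAt.mul (hL j).hasFDerivAt).mul_const (metricMatrix g x x₀ i j)
    simpa [hself] using this
  have hsum := (HasFDerivAt.fun_sum (u := Finset.univ) fun i _ ↦
    HasFDerivAt.fun_sum (u := Finset.univ) fun j _ ↦ hterm i j).const_mul (1 / 2)
  simp only [pd, pderiv, halfSqDist_eq_logChart hmem]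
  rw [hsum.fderiv]
  simp

end Log

end Manifold

/-! ### Weighted jets -/

section JetNorm

variable {F G : Type*} [NormedAddCommGroup F] [NormedSpace ℝ F] [NormedAddCommGroup G]
  [NormedSpace ℝ G]

/-- The size at `x` of `f`, `∂_a f`, `∂_b f` and `∂_a ∂_b f`, with the weight `|t|` for each
derivative. -/
def jetNorm (a b : Fin 4) (x : E4) (t : ℝ) (f : E4 → F) : ℝ :=
  ‖f x‖ + |t| * ‖pderiv a f x‖ + |t| * ‖pderiv b f x‖ + |t| ^ 2 * ‖pderiv a (pderiv b f) x‖

variable {a b : Fin 4} {x : E4} {t : ℝ}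

theorem jetNorm_nonneg (f : E4 → F) : 0 ≤ jetNorm a b x t f := by
  unfold jetNorm; positivity

theorem norm_le_jetNorm (f : E4 → F) : ‖f x‖ ≤ jetNorm a b x t f := by
  unfold jetNorm
  have : 0 ≤ |t| * ‖pderiv a f x‖ := by positivity
  have : 0 ≤ |t| * ‖pderiv b f x‖ := by positivity
  have : 0 ≤ |t| ^ 2 * ‖pderiv a (pderiv b f) x‖ := by positivity
  linarith

theorem jetNorm_congr {f h : E4 → F} (hfh : f =ᶠ[𝓝 x] h) : jetNorm a b x t f = jetNorm a b x t h := by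
  rw [jetNorm, jetNorm, hfh.eq_of_nhds, (pderiv_congr hfh a).eq_of_nhds,
    (pderiv_congr hfh b).eq_of_nhds, (pderiv_congr (pderiv_congr hfh b) a).eq_of_nhds]

theorem eventually_differentiableAt_of_two {f : E4 → F} (hf : ContDiffAt ℝ 2 f x) :
    ∀ᶠ y in 𝓝 x, DifferentiableAt ℝ f y :=
  eventually_differentiableAt (n := 1) (by exact_mod_cast hf)

theorem differentiableAt_pderiv {f : E4 → F} (hf : ContDiffAt ℝ 2 f x) (c : Fin 4) :
    DifferentiableAt ℝ (pderiv c f) x :=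
  (contDiffAt_pderiv (m := 1) hf (by norm_num) c).differentiableAt (by simp)

theorem jetNorm_add_le {f h : E4 → F} (hf : ContDiffAt ℝ 2 f x) (hh : ContDiffAt ℝ 2 h x) :
    jetNorm a b x t (fun y ↦ f y + h y) ≤ jetNorm a b x t f + jetNorm a b x t h := by
  have e1 : ∀ c, pderiv c (fun y ↦ f y + h y) =ᶠ[𝓝 x] fun y ↦ pderiv c f y + pderiv c h y := by
    intro c
    filter_upwards [eventually_differentiableAt_of_two hf,
      eventually_differentiableAt_of_two hh] with y h1 h2
    rw [pderiv_add h1 h2]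
  have e2 := (pderiv_congr (e1 b) a).eq_of_nhds
  rw [pderiv_add (differentiableAt_pderiv hf b) (differentiableAt_pderiv hh b)] at e2
  simp only [jetNorm, (e1 _).eq_of_nhds, e2]
  have i0 := norm_add_le (f x) (h x)
  have i1 := mul_le_mul_of_nonneg_left (norm_add_le (pderiv a f x) (pderiv a h x)) (abs_nonneg t)
  have i2 := mul_le_mul_of_nonneg_left (norm_add_le (pderiv b f x) (pderiv b h x)) (abs_nonneg t)
  have i3 := mul_le_mul_of_nonneg_left (norm_add_le (pderiv a (pderiv b f) x)
    (pderiv a (pderiv b h) x)) (sq_nonneg |t|)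
  linarith

theorem jetNorm_clm_comp_le (L : F →L[ℝ] G) {f : E4 → F} (hf : ContDiffAt ℝ 2 f x) :
    jetNorm a b x t (fun y ↦ L (f y)) ≤ ‖L‖ * jetNorm a b x t f := by
  have e1 : ∀ c, pderiv c (fun y ↦ L (f y)) =ᶠ[𝓝 x] fun y ↦ L (pderiv c f y) := fun c ↦
    (eventually_differentiableAt_of_two hf).mono fun y hy ↦ pderiv_clm_comp L hy c
  have e2 := (pderiv_congr (e1 b) a).eq_of_nhds
  rw [pderiv_clm_comp L (differentiableAt_pderiv hf b)] at e2
  simp only [jetNorm, (e1 _).eq_of_nhds, e2]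
  have i0 := L.le_opNorm (f x)
  have i1 := mul_le_mul_of_nonneg_left (L.le_opNorm (pderiv a f x)) (abs_nonneg t)
  have i2 := mul_le_mul_of_nonneg_left (L.le_opNorm (pderiv b f x)) (abs_nonneg t)
  have i3 := mul_le_mul_of_nonneg_left (L.le_opNorm (pderiv a (pderiv b f) x)) (sq_nonneg |t|)
  linarith

/-- In the Leibniz rule the derivatives in each term add up to the total order, so the weights
match; every term occurs in the expanded product, and the remaining ones are nonnegative. -/
theorem jetNorm_mul_le {f h : E4 → ℝ} (hf : ContDiffAt ℝ 2 f x) (hh : ContDiffAt ℝ 2 h x) :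
    jetNorm a b x t (fun y ↦ f y * h y) ≤ jetNorm a b x t f * jetNorm a b x t h := by
  have e1 : ∀ c, pderiv c (fun y ↦ f y * h y) =ᶠ[𝓝 x]
      fun y ↦ pderiv c f y * h y + f y * pderiv c h y := by
    intro c
    filter_upwards [eventually_differentiableAt_of_two hf,
      eventually_differentiableAt_of_two hh] with y h1 h2
    rw [pderiv_mul h1 h2]
  have df := hf.differentiableAt (by simp)
  have dh := hh.differentiableAt (by simp)
  have e2 := (pderiv_congr (e1 b) a).eq_of_nhds
  rw [pderiv_add (f := fun y ↦ pderiv b f y * h y) (h := fun y ↦ f y * pderiv b h y)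
    ((differentiableAt_pderiv hf b).mul dh) (df.mul (differentiableAt_pderiv hh b)), pderiv_mul (differentiableAt_pderiv hf b) dh, pderiv_mul df (differentiableAt_pderiv hh b)] at e2
  simp only [jetNorm, (e1 _).eq_of_nhds, e2, Real.norm_eq_abs]
  set s := |t|
  have hs : 0 ≤ s := abs_nonneg t
  have i1 : ∀ c, |pderiv c f x * h x + f x * pderiv c h x| ≤
      |pderiv c f x| * |h x| + |f x| * |pderiv c h x| := fun c ↦
    (abs_add_le _ _).trans_eq (by rw [abs_mul, abs_mul])
  have i2 : |pderiv a (pderiv b f) x * h x + pderiv b f x * pderiv a h x +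
      (pderiv a f x * pderiv b h x + f x * pderiv a (pderiv b h) x)| ≤
      |pderiv a (pderiv b f) x| * |h x| + |pderiv b f x| * |pderiv a h x| +
      (|pderiv a f x| * |pderiv b h x| + |f x| * |pderiv a (pderiv b h) x|) := by
    simp only [← abs_mul]
    exact (abs_add_le _ _).trans (add_le_add (abs_add_le _ _) (abs_add_le _ _))
  have j1 := mul_le_mul_of_nonneg_left (i1 a) hs
  have j2 := mul_le_mul_of_nonneg_left (i1 b) hs
  have j3 := mul_le_mul_of_nonneg_left i2 (sq_nonneg s)
  rw [abs_mul]
  have hA : 0 ≤ s * |pderiv a f x| := by positivity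
  have hB : 0 ≤ s * |pderiv b f x| := by positivity
  have hC : 0 ≤ s ^ 2 * |pderiv a (pderiv b f) x| := by positivity
  have hA' : 0 ≤ s * |pderiv a h x| := by positivity
  have hB' : 0 ≤ s * |pderiv b h x| := by positivity
  have hC' : 0 ≤ s ^ 2 * |pderiv a (pderiv b h) x| := by positivity
  linarith [mul_nonneg hA hA', mul_nonneg hB hB', mul_nonneg hA hC', mul_nonneg hB hC',
    mul_nonneg hC hA', mul_nonneg hC hB', mul_nonneg hC hC']

theorem jetNorm_comp_le {φ : ℝ → ℝ} {f : E4 → ℝ} (hφ : ContDiffAt ℝ 2 φ (f x))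
    (hf : ContDiffAt ℝ 2 f x) :
    jetNorm a b x t (fun y ↦ φ (f y)) ≤ |φ (f x)| + |deriv φ (f x)| * jetNorm a b x t f
      + |deriv (deriv φ) (f x)| * jetNorm a b x t f ^ 2 := by
  have hφ1 : ∀ᶠ y in 𝓝 x, DifferentiableAt ℝ φ (f y) :=
    hf.continuousAt.eventually (eventually_differentiableAt (n := 1) (by exact_mod_cast hφ))
  have hφ2 : DifferentiableAt ℝ (deriv φ) (f x) := by
    have : ContDiffAt ℝ 1 (fun r ↦ fderiv ℝ φ r 1) (f x) :=
      (hφ.fderiv_right (m := 1) (by norm_num)).clm_apply contDiffAt_const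
    exact this.differentiableAt (by simp)
  have e1 : ∀ c, pderiv c (fun y ↦ φ (f y)) =ᶠ[𝓝 x] fun y ↦ deriv φ (f y) * pderiv c f y := by
    intro c
    filter_upwards [eventually_differentiableAt_of_two hf, hφ1] with y h1 h2
    rw [pderiv_comp_real h2 h1]
  have df := hf.differentiableAt (by simp)
  have e2 := (pderiv_congr (e1 b) a).eq_of_nhds
  rw [pderiv_mul (f := fun y ↦ deriv φ (f y)) (hφ2.comp x df) (differentiableAt_pderiv hf b), pderiv_comp_real hφ2 df] at e2
  simp only [jetNorm, (e1 _).eq_of_nhds, e2, Real.norm_eq_abs]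
  set s := |t|
  have hs : 0 ≤ s := abs_nonneg t
  have i2 : |deriv (deriv φ) (f x) * pderiv a f x * pderiv b f x +
      deriv φ (f x) * pderiv a (pderiv b f) x| ≤ |deriv (deriv φ) (f x)| * |pderiv a f x| *
      |pderiv b f x| + |deriv φ (f x)| * |pderiv a (pderiv b f) x| := by
    simp only [← abs_mul]
    exact abs_add_le _ _
  have j3 := mul_le_mul_of_nonneg_left i2 (sq_nonneg s)
  rw [abs_mul, abs_mul]
  have hA : 0 ≤ s * |pderiv a f x| := by positivity
  have hB : 0 ≤ s * |pderiv b f x| := by positivity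
  have hC : 0 ≤ s ^ 2 * |pderiv a (pderiv b f) x| := by positivity
  have h0 := abs_nonneg (f x)
  have hsq := mul_le_mul_of_nonneg_left (mul_le_mul
    (show s * |pderiv a f x| ≤ |f x| + s * |pderiv a f x| + s * |pderiv b f x| +
      s ^ 2 * |pderiv a (pderiv b f) x| by linarith)
    (show s * |pderiv b f x| ≤ |f x| + s * |pderiv a f x| + s * |pderiv b f x| +
      s ^ 2 * |pderiv a (pderiv b f) x| by linarith) hB (by linarith))
    (abs_nonneg (deriv (deriv φ) (f x)))
  linarith [mul_nonneg (abs_nonneg (deriv φ (f x))) h0]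

end JetNorm

/-! ### Asymptotics of weighted jets along a curve -/

section JetAsymptotics

open Asymptotics

variable {a b : Fin 4} {x : E4}

/-! ### Two-point functions restricted to the trajectory -/

section TwoPoint

variable {z : ℝ → E4} {v : E4}

theorem tendsto_pair (hz : HasDerivAt z v 0) (hz0 : z 0 = x) :
    Tendsto (fun t ↦ (x, z t)) (𝓝[≠] 0) (𝓝 (x, x)) := by
  have h : Tendsto z (𝓝[≠] 0) (𝓝 x) := by
    rw [← hz0]; exact hz.continuousAt.tendsto.mono_left nhdsWithin_le_nhds
  exact tendsto_const_nhds.prodMk_nhds h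

theorem isBigO_norm_sub (hz : HasDerivAt z v 0) (hz0 : z 0 = x) :
    (fun t ↦ ‖x - z t‖) =O[𝓝[≠] 0] fun t ↦ t := by
  have h := hz.isBigO_sub.mono (nhdsWithin_le_nhds (s := {(0 : ℝ)}ᶜ))
  simp only [hz0, sub_zero] at h
  exact h.norm_left.congr_left fun t ↦ norm_sub_rev _ _

theorem eventually_contDiffAt_left {H : E4 × E4 → ℝ} {n : ℕ} (hz : HasDerivAt z v 0)
    (hz0 : z 0 = x) (hH : ContDiffAt ℝ n H (x, x)) :
    ∀ᶠ t in 𝓝[≠] 0, ContDiffAt ℝ n (fun y ↦ H (y, z t)) x :=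
  ((tendsto_pair hz hz0).eventually (eventually_contDiffAt hH)).mono fun _ ht ↦ contDiffAt_left ht

/-- Each derivative lowers the order of vanishing by one and its weight restores one power of `t`,
so all four terms have the same size. -/
theorem isLittleO_jetNorm {H : E4 × E4 → ℝ} {n : ℕ} (hz : HasDerivAt z v 0) (hz0 : z 0 = x)
    (hH : ContDiffAt ℝ ((n + 2 : ℕ) : WithTop ℕ∞) H (x, x))
    (hv : ∀ᶠ w in 𝓝 x, VanishesToOrder w (n + 2) (fun y ↦ H (y, w))) :
    (fun t ↦ jetNorm a b x t fun y ↦ H (y, z t)) =o[𝓝[≠] 0] fun t ↦ t ^ (n + 2) := by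
  have key : ∀ {K : E4 × E4 → ℝ} {m : ℕ}, ContDiffAt ℝ m K (x, x) →
      (∀ᶠ w in 𝓝 x, VanishesToOrder w m (fun y ↦ K (y, w))) →
      (fun t ↦ ‖K (x, z t)‖) =o[𝓝[≠] 0] fun t ↦ t ^ m := fun hK hvK ↦
    (((isLittleO_of_vanishesToOrder hK hvK).comp_tendsto (tendsto_pair hz hz0)).trans_isBigO
      ((isBigO_norm_sub hz hz0).pow _)).norm_left
  have habs : (fun t : ℝ ↦ |t|) =O[𝓝[≠] 0] fun t ↦ t := (isBigO_refl _ _).abs_left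
  have h1 : ∀ c, (fun t ↦ |t| * ‖pd c H (x, z t)‖) =o[𝓝[≠] 0] fun t ↦ t ^ (n + 2) := fun c ↦
    (habs.mul_isLittleO (key (contDiffAt_pd hH c) (vanishesToOrder_pd hv c))).congr_right
      fun t ↦ by ring
  have h2 : (fun t ↦ |t| ^ 2 * ‖pd a (pd b H) (x, z t)‖) =o[𝓝[≠] 0] fun t ↦ t ^ (n + 2) :=
    ((habs.pow 2).mul_isLittleO (key (contDiffAt_pd (contDiffAt_pd hH b) a)
      (vanishesToOrder_pd (vanishesToOrder_pd hv b) a))).congr_right fun t ↦ by ring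
  exact (((key hH hv).add (h1 a)).add (h1 b)).add h2

theorem isBigO_jetNorm {H : E4 × E4 → ℝ} {n : ℕ} (hz : HasDerivAt z v 0) (hz0 : z 0 = x)
    (hH : ContDiffAt ℝ ((n + 3 : ℕ) : WithTop ℕ∞) H (x, x))
    (hv : ∀ᶠ w in 𝓝 x, VanishesToOrder w (n + 2) (fun y ↦ H (y, w))) :
    (fun t ↦ jetNorm a b x t fun y ↦ H (y, z t)) =O[𝓝[≠] 0] fun t ↦ t ^ (n + 3) := by
  have key : ∀ {K : E4 × E4 → ℝ} {m : ℕ}, ContDiffAt ℝ ((m + 1 : ℕ) : WithTop ℕ∞) K (x, x) →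
      (∀ᶠ w in 𝓝 x, VanishesToOrder w m (fun y ↦ K (y, w))) →
      (fun t ↦ ‖K (x, z t)‖) =O[𝓝[≠] 0] fun t ↦ t ^ (m + 1) := fun hK hvK ↦
    (((isBigO_of_vanishesToOrder hK hvK).comp_tendsto (tendsto_pair hz hz0)).trans
      ((isBigO_norm_sub hz hz0).pow _)).norm_left
  have habs : (fun t : ℝ ↦ |t|) =O[𝓝[≠] 0] fun t ↦ t := (isBigO_refl _ _).abs_left
  have h1 : ∀ c, (fun t ↦ |t| * ‖pd c H (x, z t)‖) =O[𝓝[≠] 0] fun t ↦ t ^ (n + 3) := fun c ↦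
    (habs.mul (key (contDiffAt_pd hH c) (vanishesToOrder_pd hv c))).congr_right
      fun t ↦ by ring
  have h2 : (fun t ↦ |t| ^ 2 * ‖pd a (pd b H) (x, z t)‖) =O[𝓝[≠] 0] fun t ↦ t ^ (n + 3) :=
    ((habs.pow 2).mul (key (contDiffAt_pd (contDiffAt_pd hH b) a)
      (vanishesToOrder_pd (vanishesToOrder_pd hv b) a))).congr_right fun t ↦ by ring
  exact (((key hH hv).add (h1 a)).add (h1 b)).add h2

theorem isBigO_abs_one : (fun t : ℝ ↦ |t|) =O[𝓝[≠] 0] fun _ ↦ (1 : ℝ) :=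
  ((continuous_abs.tendsto (0 : ℝ)).mono_left nhdsWithin_le_nhds).isBigO_one ℝ

theorem isBigO_one_of_continuousAt {K : E4 × E4 → ℝ} (hz : HasDerivAt z v 0) (hz0 : z 0 = x)
    (hK : ContinuousAt K (x, x)) : (fun t ↦ ‖K (x, z t)‖) =O[𝓝[≠] 0] fun _ ↦ (1 : ℝ) :=
  ((hK.tendsto.comp (tendsto_pair hz hz0)).isBigO_one ℝ).norm_left

theorem isBigO_jetNorm_one {H : E4 × E4 → ℝ} (hz : HasDerivAt z v 0) (hz0 : z 0 = x)
    (hH : ContDiffAt ℝ ((2 : ℕ) : WithTop ℕ∞) H (x, x)) :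
    (fun t ↦ jetNorm a b x t fun y ↦ H (y, z t)) =O[𝓝[≠] 0] fun _ ↦ (1 : ℝ) := by
  have h1 : ∀ c, (fun t ↦ |t| * ‖pd c H (x, z t)‖) =O[𝓝[≠] 0] fun _ ↦ (1 : ℝ) := fun c ↦
    (isBigO_abs_one.mul (isBigO_one_of_continuousAt hz hz0
      (contDiffAt_pd (n := 1) hH c).continuousAt)).congr_right fun t ↦ one_mul _
  have h2 : (fun t ↦ |t| ^ 2 * ‖pd a (pd b H) (x, z t)‖) =O[𝓝[≠] 0] fun _ ↦ (1 : ℝ) :=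
    ((isBigO_abs_one.pow 2).mul (isBigO_one_of_continuousAt hz hz0
      (contDiffAt_pd (n := 0) (contDiffAt_pd (n := 1) hH b) a).continuousAt)).congr_right
        fun t ↦ by simp
  exact (((isBigO_one_of_continuousAt hz hz0 hH.continuousAt).add (h1 a)).add (h1 b)).add h2

/-- This is applied to half the squared distance: its value is `O(t ^ 2)` by the limit, its first
derivatives are `O(t)` because they vanish at `(x, x)`, and its second derivatives are bounded. -/
theorem isBigO_jetNorm_sq {H : E4 × E4 → ℝ} {c : ℝ} (hz : HasDerivAt z v 0) (hz0 : z 0 = x)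
    (hH : ContDiffAt ℝ ((2 : ℕ) : WithTop ℕ∞) H (x, x)) (hpd : ∀ μ, pd μ H (x, x) = 0)
    (hlim : Tendsto (fun t ↦ H (x, z t) / t ^ 2) (𝓝[≠] 0) (𝓝 c)) :
    (fun t ↦ jetNorm a b x t fun y ↦ H (y, z t)) =O[𝓝[≠] 0] fun t ↦ t ^ 2 := by
  have habs : (fun t : ℝ ↦ |t|) =O[𝓝[≠] 0] fun t ↦ t := (isBigO_refl _ _).abs_left
  have h0 : (fun t ↦ ‖H (x, z t)‖) =O[𝓝[≠] 0] fun t ↦ t ^ 2 := by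
    refine IsBigO.norm_left ?_
    refine (((hlim.isBigO_one ℝ).mul (isBigO_refl (fun t : ℝ ↦ t ^ 2) _)).congr' ?_ ?_)
    · filter_upwards [self_mem_nhdsWithin] with t ht
      have : t ≠ 0 := ht
      field_simp
    · exact Eventually.of_forall fun t ↦ one_mul _
  have h1 : ∀ μ, (fun t ↦ |t| * ‖pd μ H (x, z t)‖) =O[𝓝[≠] 0] fun t ↦ t ^ 2 := fun μ ↦ by
    have hd : DifferentiableAt ℝ (pd μ H) (x, x) :=
      (contDiffAt_pd (n := 1) hH μ).differentiableAt (by simp)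
    have h2 := hd.isBigO_sub.comp_tendsto (tendsto_pair hz hz0)
    have h3 : (fun t ↦ ‖pd μ H (x, z t)‖) =O[𝓝[≠] 0] fun t ↦ t := by
      refine IsBigO.norm_left ((h2.congr_left fun t ↦ by simp [hpd]).trans ?_)
      refine IsBigO.trans (IsBigO.of_bound 1 (Eventually.of_forall fun t ↦ ?_))
        (isBigO_norm_sub hz hz0)
      simp [Prod.norm_def, norm_sub_rev]
    exact (habs.mul h3).congr_right fun t ↦ by ring
  have h2 : (fun t ↦ |t| ^ 2 * ‖pd a (pd b H) (x, z t)‖) =O[𝓝[≠] 0] fun t ↦ t ^ 2 :=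
    ((habs.pow 2).mul (isBigO_one_of_continuousAt hz hz0
      (contDiffAt_pd (n := 0) (contDiffAt_pd (n := 1) hH b) a).continuousAt)).congr_right
        fun t ↦ by simp
  exact ((h0.add (h1 a)).add (h1 b)).add h2

end TwoPoint

/-! ### Inverses and logarithms of families of functions -/

section Families

variable {f : ℝ → E4 → ℝ} {c : ℝ}

theorem eventually_ne_zero_of_tendsto_div_sq {s : ℝ → ℝ} (hc : c ≠ 0)
    (hlim : Tendsto (fun t ↦ s t / t ^ 2) (𝓝[≠] 0) (𝓝 c)) : ∀ᶠ t in 𝓝[≠] 0, s t ≠ 0 := by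
  filter_upwards [hlim.eventually_ne hc] with t ht h
  exact ht (by rw [h, zero_div])

theorem isBigO_inv_of_tendsto_div_sq {s : ℝ → ℝ} (hc : c ≠ 0)
    (hlim : Tendsto (fun t ↦ s t / t ^ 2) (𝓝[≠] 0) (𝓝 c)) :
    (fun t ↦ |(s t)⁻¹|) =O[𝓝[≠] 0] fun t ↦ (t ^ 2)⁻¹ := by
  refine IsBigO.abs_left ?_
  refine ((((hlim.inv₀ hc).isBigO_one ℝ).mul
    (isBigO_refl (fun t : ℝ ↦ (t ^ 2)⁻¹) _)).congr' ?_ ?_)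
  · filter_upwards [self_mem_nhdsWithin] with t ht
    have : t ≠ 0 := ht
    field_simp
  · exact Eventually.of_forall fun t ↦ one_mul _

theorem deriv_deriv_inv {s : ℝ} (hs : s ≠ 0) :
    deriv (deriv fun r : ℝ ↦ r⁻¹) s = 2 * s⁻¹ ^ 3 := by
  rw [deriv_inv']
  have h := ((hasDerivAt_pow 2 s).inv (pow_ne_zero 2 hs)).neg.deriv
  erw [h]
  field_simp
  norm_num [mul_comm]

theorem isBigO_jetNorm_inv (hc : c ≠ 0) (hf : ∀ᶠ t in 𝓝[≠] 0, ContDiffAt ℝ 2 (f t) x)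
    (hN : (fun t ↦ jetNorm a b x t (f t)) =O[𝓝[≠] 0] fun t ↦ t ^ 2)
    (hlim : Tendsto (fun t ↦ f t x / t ^ 2) (𝓝[≠] 0) (𝓝 c)) :
    (fun t ↦ jetNorm a b x t fun y ↦ (f t y)⁻¹) =O[𝓝[≠] 0] fun t ↦ (t ^ 2)⁻¹ := by
  have hi := isBigO_inv_of_tendsto_div_sq hc hlim
  have hbound : (fun t ↦ |(f t x)⁻¹| + |(f t x)⁻¹| ^ 2 * jetNorm a b x t (f t)
      + 2 * |(f t x)⁻¹| ^ 3 * jetNorm a b x t (f t) ^ 2) =O[𝓝[≠] 0] fun t ↦ (t ^ 2)⁻¹ := by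
    refine (hi.add ?_).add ?_
    · refine ((hi.pow 2).mul hN).congr' EventuallyEq.rfl ?_
      filter_upwards [self_mem_nhdsWithin] with t ht
      have : t ≠ 0 := ht
      field_simp
    · refine (((hi.pow 3).const_mul_left 2).mul (hN.pow 2)).congr' EventuallyEq.rfl ?_
      filter_upwards [self_mem_nhdsWithin] with t ht
      have : t ≠ 0 := ht
      field_simp
  refine IsBigO.trans (IsBigO.of_bound 1 ?_) hbound
  filter_upwards [hf, eventually_ne_zero_of_tendsto_div_sq hc hlim] with t ht hne
  have h := jetNorm_comp_le (a := a) (b := b) (t := t) (φ := fun r ↦ r⁻¹) (contDiffAt_inv ℝ hne) ht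
  rw [deriv_deriv_inv hne, deriv_inv] at h
  rw [one_mul, Real.norm_of_nonneg (jetNorm_nonneg _)]
  refine (h.trans_eq ?_).trans (Real.le_norm_self _)
  simp only [abs_neg, abs_mul, abs_pow, abs_inv, abs_two, inv_pow]

/-- The derivative terms are bounded; only the value diverges, like `log |t|`. The crude bound
`o(1/t)` is all that is needed against a factor `O(t ^ 3)`. -/
theorem isLittleO_jetNorm_log {d : ℝ} (hd : d ≠ 0) (hc : c ≠ 0)
    (hf : ∀ᶠ t in 𝓝[≠] 0, ContDiffAt ℝ 2 (f t) x)
    (hN : (fun t ↦ jetNorm a b x t (f t)) =O[𝓝[≠] 0] fun t ↦ t ^ 2)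
    (hlim : Tendsto (fun t ↦ f t x / t ^ 2) (𝓝[≠] 0) (𝓝 c)) :
    (fun t ↦ jetNorm a b x t fun y ↦ Real.log (f t y / d)) =o[𝓝[≠] 0] fun t ↦ t⁻¹ := by
  have hi := isBigO_inv_of_tendsto_div_sq hc hlim
  have hone : (fun _ ↦ (1 : ℝ)) =o[𝓝[≠] 0] fun t : ℝ ↦ t⁻¹ := by
    rw [isLittleO_one_left_iff]
    simpa using tendsto_norm_inv_nhdsNE_zero_atTop (α := ℝ)
  have hlog : (fun t ↦ |Real.log (f t x / d)|) =o[𝓝[≠] 0] fun t ↦ t⁻¹ := by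
    refine IsLittleO.abs_left ?_
    have h1 : Tendsto (fun t ↦ Real.log (f t x / t ^ 2 / d)) (𝓝[≠] 0) (𝓝 (Real.log (c / d))) :=
      (hlim.div_const d).log (div_ne_zero hc hd)
    have h2 : (fun t ↦ Real.log t) =o[𝓝[≠] 0] fun t : ℝ ↦ t⁻¹ := by
      rw [isLittleO_iff_tendsto']
      · have h3 : Tendsto (fun t : ℝ ↦ t * Real.log t) (𝓝[≠] 0) (𝓝 0) := by
          simpa using (Real.continuous_mul_log.tendsto 0).mono_left nhdsWithin_le_nhds
        exact h3.congr fun t ↦ by rw [div_inv_eq_mul, mul_comm]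
      · filter_upwards [self_mem_nhdsWithin] with t ht h
        exact absurd (inv_eq_zero.1 h) ht
    refine (((h1.isBigO_one ℝ).trans_isLittleO hone).add (h2.const_mul_left 2)).congr' ?_
      EventuallyEq.rfl
    filter_upwards [self_mem_nhdsWithin, eventually_ne_zero_of_tendsto_div_sq hc hlim] with t ht hne
    have ht0 : t ≠ 0 := ht
    -- The logarithm splits into a convergent part and `2 log t`. Since `Real.log` is `log |·|`,
    -- negative `t` and negative `f t x` are covered.
    have h4 : f t x / d = f t x / t ^ 2 / d * t ^ 2 := by field_simp
    rw [h4, Real.log_mul (by positivity) (by positivity), Real.log_pow]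
    norm_num
  have hbound : (fun t ↦ |Real.log (f t x / d)| + |(f t x)⁻¹| * jetNorm a b x t (f t)
      + |(f t x)⁻¹| ^ 2 * jetNorm a b x t (f t) ^ 2) =o[𝓝[≠] 0] fun t ↦ t⁻¹ := by
    refine (hlog.add ?_).add ?_
    · refine IsBigO.trans_isLittleO ((hi.mul hN).congr' EventuallyEq.rfl ?_) hone
      filter_upwards [self_mem_nhdsWithin] with t ht
      have : t ≠ 0 := ht
      field_simp
    · refine IsBigO.trans_isLittleO (((hi.pow 2).mul (hN.pow 2)).congr' EventuallyEq.rfl ?_) hone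
      filter_upwards [self_mem_nhdsWithin] with t ht
      have : t ≠ 0 := ht
      field_simp
  refine IsBigO.trans_isLittleO (IsBigO.of_bound 1 ?_) hbound
  filter_upwards [hf, eventually_ne_zero_of_tendsto_div_sq hc hlim] with t ht hne
  have hφ : ContDiffAt ℝ 2 (fun r ↦ Real.log (r / d)) (f t x) :=
    (contDiffAt_id.div_const d).log (div_ne_zero hne hd)
  have hd1 : ∀ r : ℝ, r ≠ 0 → deriv (fun r ↦ Real.log (r / d)) r = r⁻¹ := fun r hr ↦ by
    have := (((hasDerivAt_id r).div_const d).log (div_ne_zero hr hd)).deriv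
    simp only [id] at this
    rw [this]
    field_simp
  have hd2 : deriv (deriv fun r ↦ Real.log (r / d)) (f t x) = -((f t x) ^ 2)⁻¹ := by
    have h1 : deriv (fun r ↦ Real.log (r / d)) =ᶠ[𝓝 (f t x)] fun r ↦ r⁻¹ :=
      Filter.mem_of_superset (isOpen_ne.mem_nhds hne) hd1
    rw [h1.deriv_eq, deriv_inv]
  have h := jetNorm_comp_le (a := a) (b := b) (t := t) hφ ht
  rw [hd2, hd1 _ hne] at h
  rw [one_mul, Real.norm_of_nonneg (jetNorm_nonneg _)]
  refine (h.trans_eq ?_).trans (Real.le_norm_self _)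
  simp only [abs_neg, abs_pow, abs_inv, inv_pow]

theorem isBigO_jetNorm_log_one_add (hf : ∀ᶠ t in 𝓝[≠] 0, ContDiffAt ℝ 2 (f t) x)
    (hN : Tendsto (fun t ↦ jetNorm a b x t (f t)) (𝓝[≠] 0) (𝓝 0)) :
    (fun t ↦ jetNorm a b x t fun y ↦ Real.log (1 + f t y)) =O[𝓝[≠] 0]
      fun t ↦ jetNorm a b x t (f t) := by
  have hfx : Tendsto (fun t ↦ f t x) (𝓝[≠] 0) (𝓝 0) :=
    squeeze_zero_norm (fun t ↦ norm_le_jetNorm (f t)) hN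
  have hlog : (fun t ↦ |Real.log (1 + f t x)|) =O[𝓝[≠] 0] fun t ↦ jetNorm a b x t (f t) := by
    refine IsBigO.abs_left ?_
    have h1 : HasDerivAt (fun r : ℝ ↦ Real.log (1 + r)) 1 0 := by
      simpa using ((hasDerivAt_id (0 : ℝ)).const_add 1).log (by simp)
    have h2 := h1.isBigO_sub.comp_tendsto hfx
    refine (h2.congr (fun t ↦ by simp) (fun t ↦ by simp)).trans
      (IsBigO.of_bound 1 (Eventually.of_forall fun t ↦ ?_) : (fun t ↦ f t x) =O[𝓝[≠] 0] _)
    rw [one_mul, Real.norm_of_nonneg (jetNorm_nonneg _)]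
    exact norm_le_jetNorm (f t)
  have hi : (fun t ↦ |(1 + f t x)⁻¹|) =O[𝓝[≠] 0] fun _ ↦ (1 : ℝ) := by
    have h1 : Tendsto (fun t ↦ (1 + f t x)⁻¹) (𝓝[≠] 0) (𝓝 (1 + 0)⁻¹) :=
      (hfx.const_add 1).inv₀ (by simp)
    exact (h1.isBigO_one ℝ).abs_left
  have hN1 : (fun t ↦ jetNorm a b x t (f t)) =O[𝓝[≠] 0] fun _ ↦ (1 : ℝ) := hN.isBigO_one ℝ
  have hbound : (fun t ↦ |Real.log (1 + f t x)| + |(1 + f t x)⁻¹| * jetNorm a b x t (f t)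
      + |(1 + f t x)⁻¹| ^ 2 * jetNorm a b x t (f t) ^ 2) =O[𝓝[≠] 0]
      fun t ↦ jetNorm a b x t (f t) := by
    refine (hlog.add ?_).add ?_
    · exact (hi.mul (isBigO_refl _ _)).congr_right fun t ↦ one_mul _
    · exact ((hi.pow 2).mul ((hN1.mul (isBigO_refl _ _)).congr_left fun t ↦ (sq _).symm)).congr_right
        fun t ↦ by ring
  refine IsBigO.trans (IsBigO.of_bound 1 ?_) hbound
  have hne : ∀ᶠ t in 𝓝[≠] 0, 1 + f t x ≠ 0 :=
    (hfx.const_add 1).eventually_ne (by simp)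
  filter_upwards [hf, hne] with t ht hne
  have hφ : ContDiffAt ℝ 2 (fun r ↦ Real.log (1 + r)) (f t x) :=
    (contDiffAt_const.add contDiffAt_id).log hne
  have hd1 : ∀ r : ℝ, 1 + r ≠ 0 → deriv (fun r ↦ Real.log (1 + r)) r = (1 + r)⁻¹ := fun r hr ↦ by
    have := (((hasDerivAt_id r).const_add 1).log hr).deriv
    simpa using this
  have hd2 : deriv (deriv fun r ↦ Real.log (1 + r)) (f t x) = -((1 + f t x) ^ 2)⁻¹ := by
    have h1 : deriv (fun r ↦ Real.log (1 + r)) =ᶠ[𝓝 (f t x)] fun r ↦ (1 + r)⁻¹ := by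
      have : ∀ᶠ r in 𝓝 (f t x), 1 + r ≠ 0 :=
        (continuous_const.add continuous_id).continuousAt.eventually_ne hne
      exact this.mono hd1
    rw [h1.deriv_eq]
    have := (((hasDerivAt_id (f t x)).const_add 1).inv hne).deriv
    erw [this]
    simp [div_eq_mul_inv]
  have h := jetNorm_comp_le (a := a) (b := b) (t := t) hφ ht
  rw [hd2, hd1 _ hne] at h
  rw [one_mul, Real.norm_of_nonneg (jetNorm_nonneg _)]
  refine (h.trans_eq ?_).trans (Real.le_norm_self _)
  simp only [abs_neg, abs_pow, abs_inv, inv_pow]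

end Families

end JetAsymptotics

/-! ### The difference of two Hadamard expressions -/

section HadamardDifference

open Asymptotics

/-- The real part of the difference of two Hadamard expressions, without the factor `8 π²`. -/
def hadamardDiff (d : ℝ) (S S' U U' V V' : E4 × E4 → ℝ) (q : E4 × E4) : ℝ :=
  U q / S q - U' q / S' q + (V q * Real.log (S q / d) - V' q * Real.log (S' q / d))

/-- Each summand isolates one difference of exact and approximate data. `Real.log` ignores signs, so
the quotient rule for logarithms needs only nonzero arguments. -/
theorem hadamardDiff_eq {d : ℝ} (hd : d ≠ 0) {S S' : E4 × E4 → ℝ} (U U' V V' : E4 × E4 → ℝ)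
    {q : E4 × E4} (hS : S q ≠ 0) (hS' : S' q ≠ 0) :
    hadamardDiff d S S' U U' V V' q = (U q - U' q) * (S q)⁻¹
      + (U' q * ((S' q - S q) * ((S q)⁻¹ * (S' q)⁻¹))
        + ((V q - V' q) * Real.log (S q / d)
          + -V' q * Real.log (1 + (S' q - S q) * (S q)⁻¹))) := by
  have h1 : 1 + (S' q - S q) * (S q)⁻¹ = S' q / d / (S q / d) := by field_simp; ring
  rw [hadamardDiff, h1, Real.log_div (div_ne_zero hS' hd) (div_ne_zero hS hd)]
  field_simp
  ring

variable {a b : Fin 4} {x : E4} {z : ℝ → E4} {v : E4} {d c : ℝ} {S S' U U' V V' : E4 × E4 → ℝ}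

theorem tendsto_div_sq_of_isLittleO {s s' : ℝ → ℝ}
    (hs : Tendsto (fun t ↦ s t / t ^ 2) (𝓝[≠] 0) (𝓝 c))
    (hss' : (fun t ↦ s' t - s t) =o[𝓝[≠] 0] fun t ↦ t ^ 2) :
    Tendsto (fun t ↦ s' t / t ^ 2) (𝓝[≠] 0) (𝓝 c) := by
  have h := hs.add hss'.tendsto_div_nhds_zero
  rw [add_zero] at h
  exact h.congr fun t ↦ by ring

theorem isLittleO_pow_pow_punctured {m n : ℕ} (h : m < n) :
    (fun t : ℝ ↦ t ^ n) =o[𝓝[≠] 0] fun t ↦ t ^ m :=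
  (isLittleO_pow_pow h).mono nhdsWithin_le_nhds

theorem eventually_contDiffAt_hadamardDiff (hd : d ≠ 0) (hz : HasDerivAt z v 0) (hz0 : z 0 = x)
    (cS : ContDiffAt ℝ (6 : ℕ) S (x, x)) (cS' : ContDiffAt ℝ (6 : ℕ) S' (x, x))
    (cU : ContDiffAt ℝ (4 : ℕ) U (x, x)) (cU' : ContDiffAt ℝ (4 : ℕ) U' (x, x))
    (cV : ContDiffAt ℝ (3 : ℕ) V (x, x)) (cV' : ContDiffAt ℝ (3 : ℕ) V' (x, x))
    (hS : ∀ᶠ t in 𝓝[≠] 0, S (x, z t) ≠ 0) (hS' : ∀ᶠ t in 𝓝[≠] 0, S' (x, z t) ≠ 0) :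
    ∀ᶠ t in 𝓝[≠] 0, ContDiffAt ℝ 2 (fun y ↦ hadamardDiff d S S' U U' V V' (y, z t)) x := by
  have reg : ∀ {n : ℕ} {K : E4 × E4 → ℝ}, 2 ≤ n → ContDiffAt ℝ n K (x, x) →
      ∀ᶠ t in 𝓝[≠] 0, ContDiffAt ℝ 2 (fun y ↦ K (y, z t)) x := fun hn hK ↦
    (eventually_contDiffAt_left hz hz0 hK).mono fun t ht ↦ ht.of_le (by exact_mod_cast hn)
  filter_upwards [reg (by norm_num) cS, reg (by norm_num) cS', reg (by norm_num) cU,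
    reg (by norm_num) cU', reg (by norm_num) cV, reg (by norm_num) cV', hS, hS']
    with t h1 h2 h3 h4 h5 h6 h7 h8
  exact ((h3.div h1 h7).sub (h4.div h2 h8)).add
    ((h5.mul ((h1.div_const d).log (div_ne_zero h7 hd))).sub
      (h6.mul ((h2.div_const d).log (div_ne_zero h8 hd))))

/-- The powers of the four summands are `4 - 2`, `6 - 2 - 2`, `3 - 1` and `6 - 2`. The first three
give exactly `o(t ^ 2)`, which is where the orders 6 and 4 and the third derivative of `V'` are used
up. -/
theorem isLittleO_jetNorm_hadamardDiff (hd : d ≠ 0) (hc : c ≠ 0) (hz : HasDerivAt z v 0)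
    (hz0 : z 0 = x)
    (cS : ContDiffAt ℝ (6 : ℕ) S (x, x)) (cS' : ContDiffAt ℝ (6 : ℕ) S' (x, x))
    (cU : ContDiffAt ℝ (4 : ℕ) U (x, x)) (cU' : ContDiffAt ℝ (4 : ℕ) U' (x, x))
    (cV : ContDiffAt ℝ (3 : ℕ) V (x, x)) (cV' : ContDiffAt ℝ (3 : ℕ) V' (x, x))
    (vS : ∀ᶠ w in 𝓝 x, VanishesToOrder w 6 (fun y ↦ S' (y, w) - S (y, w)))
    (vU : ∀ᶠ w in 𝓝 x, VanishesToOrder w 4 (fun y ↦ U (y, w) - U' (y, w)))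
    (vV : ∀ᶠ w in 𝓝 x, VanishesToOrder w 2 (fun y ↦ V (y, w) - V' (y, w)))
    (hpd : ∀ μ, pd μ S (x, x) = 0)
    (hlim : Tendsto (fun t ↦ S (x, z t) / t ^ 2) (𝓝[≠] 0) (𝓝 c)) :
    (fun t ↦ jetNorm a b x t fun y ↦ hadamardDiff d S S' U U' V V' (y, z t)) =o[𝓝[≠] 0]
      fun t ↦ t ^ 2 := by
  have reg : ∀ {n : ℕ} {K : E4 × E4 → ℝ}, 2 ≤ n → ContDiffAt ℝ n K (x, x) →
      ∀ᶠ t in 𝓝[≠] 0, ContDiffAt ℝ 2 (fun y ↦ K (y, z t)) x := fun hn hK ↦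
    (eventually_contDiffAt_left hz hz0 hK).mono fun t ht ↦ ht.of_le (by exact_mod_cast hn)
  have rS := reg (by norm_num) cS
  have rS' := reg (by norm_num) cS'
  have rU := reg (by norm_num) cU
  have rU' := reg (by norm_num) cU'
  have rV := reg (by norm_num) cV
  have rV' := reg (by norm_num) cV'
  have nK : (fun t ↦ jetNorm a b x t fun y ↦ S' (y, z t) - S (y, z t)) =o[𝓝[≠] 0]
      fun t ↦ t ^ 6 :=
    isLittleO_jetNorm (H := fun q ↦ S' q - S q) (n := 4) hz hz0 (cS'.sub cS) vS
  have nU : (fun t ↦ jetNorm a b x t fun y ↦ U (y, z t) - U' (y, z t)) =o[𝓝[≠] 0]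
      fun t ↦ t ^ 4 :=
    isLittleO_jetNorm (H := fun q ↦ U q - U' q) (n := 2) hz hz0 (cU.sub cU') vU
  have nW : (fun t ↦ jetNorm a b x t fun y ↦ V (y, z t) - V' (y, z t)) =O[𝓝[≠] 0]
      fun t ↦ t ^ 3 :=
    isBigO_jetNorm (H := fun q ↦ V q - V' q) (n := 0) hz hz0 (cV.sub cV') vV
  have nU' : (fun t ↦ jetNorm a b x t fun y ↦ U' (y, z t)) =O[𝓝[≠] 0] fun _ ↦ (1 : ℝ) :=
    isBigO_jetNorm_one hz hz0 (cU'.of_le (by norm_num))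
  have nV' : (fun t ↦ jetNorm a b x t fun y ↦ -V' (y, z t)) =O[𝓝[≠] 0] fun _ ↦ (1 : ℝ) :=
    isBigO_jetNorm_one (H := fun q ↦ -V' q) hz hz0 (cV'.neg.of_le (by norm_num))
  have nS : (fun t ↦ jetNorm a b x t fun y ↦ S (y, z t)) =O[𝓝[≠] 0] fun t ↦ t ^ 2 :=
    isBigO_jetNorm_sq hz hz0 (cS.of_le (by norm_num)) hpd hlim
  have hK2 : (fun t ↦ S' (x, z t) - S (x, z t)) =o[𝓝[≠] 0] fun t ↦ t ^ 2 := by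
    refine IsBigO.trans_isLittleO (IsBigO.of_bound 1 (Eventually.of_forall fun t ↦ ?_))
      (nK.trans (isLittleO_pow_pow_punctured (by norm_num)))
    rw [one_mul, Real.norm_of_nonneg (jetNorm_nonneg _)]
    exact norm_le_jetNorm (a := a) (b := b) (t := t) fun y ↦ S' (y, z t) - S (y, z t)
  -- `S'` inherits the leading term `c t ^ 2`, so it too is nonzero along the trajectory and has an
  -- inverse of size `O(t ^ (-2))`.
  have hlim' := tendsto_div_sq_of_isLittleO hlim hK2
  have nS' : (fun t ↦ jetNorm a b x t fun y ↦ S' (y, z t)) =O[𝓝[≠] 0] fun t ↦ t ^ 2 := by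
    refine IsBigO.trans (IsBigO.of_bound 1 ?_)
      (nS.add (nK.trans (isLittleO_pow_pow_punctured (by norm_num : 2 < 6))).isBigO)
    filter_upwards [rS, rS'] with t h1 h2
    rw [one_mul, Real.norm_of_nonneg (jetNorm_nonneg _)]
    refine le_trans ?_ ((jetNorm_add_le h1 (h2.sub h1)).trans (Real.le_norm_self _))
    simp
  have hS0 := eventually_ne_zero_of_tendsto_div_sq hc hlim
  have hS0' := eventually_ne_zero_of_tendsto_div_sq hc hlim'
  have nI := isBigO_jetNorm_inv (a := a) (b := b) hc rS nS hlim
  have nI' := isBigO_jetNorm_inv (a := a) (b := b) hc rS' nS' hlim'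
  have nL := isLittleO_jetNorm_log (a := a) (b := b) hd hc rS nS hlim
  have rKI : ∀ᶠ t in 𝓝[≠] 0,
      ContDiffAt ℝ 2 (fun y ↦ (S' (y, z t) - S (y, z t)) * (S (y, z t))⁻¹) x := by
    filter_upwards [rS, rS', hS0] with t h1 h2 h3
    exact (h2.sub h1).mul (h1.inv h3)
  have cancel : ∀ {m n k : ℕ}, m = n + k →
      (fun t : ℝ ↦ t ^ m * (t ^ k)⁻¹) =ᶠ[𝓝[≠] 0] fun t ↦ t ^ n := by
    rintro m n k rfl
    filter_upwards [self_mem_nhdsWithin] with t ht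
    rw [pow_add, mul_inv_cancel_right₀ (pow_ne_zero k ht)]
  have nKI : (fun t ↦ jetNorm a b x t fun y ↦ (S' (y, z t) - S (y, z t)) * (S (y, z t))⁻¹)
      =o[𝓝[≠] 0] fun t ↦ t ^ 4 := by
    refine IsBigO.trans_isLittleO (IsBigO.of_bound 1 ?_)
      ((nK.mul_isBigO nI).congr' EventuallyEq.rfl (cancel (by norm_num)))
    filter_upwards [rS, rS', hS0] with t h1 h2 h3
    rw [one_mul, Real.norm_of_nonneg (jetNorm_nonneg _)]
    exact (jetNorm_mul_le (h2.sub h1) (h1.inv h3)).trans (Real.le_norm_self _)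
  have nM : (fun t ↦ jetNorm a b x t fun y ↦
      Real.log (1 + (S' (y, z t) - S (y, z t)) * (S (y, z t))⁻¹)) =o[𝓝[≠] 0] fun t ↦ t ^ 4 := by
    refine (isBigO_jetNorm_log_one_add rKI (nKI.trans_tendsto ?_)).trans_isLittleO nKI
    have : Continuous fun t : ℝ ↦ t ^ 4 := by fun_prop
    simpa using (this.tendsto 0).mono_left nhdsWithin_le_nhds
  have hbound : (fun t ↦
      jetNorm a b x t (fun y ↦ U (y, z t) - U' (y, z t)) * jetNorm a b x t (fun y ↦ (S (y, z t))⁻¹)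
      + (jetNorm a b x t (fun y ↦ U' (y, z t)) *
          (jetNorm a b x t (fun y ↦ S' (y, z t) - S (y, z t)) *
            (jetNorm a b x t (fun y ↦ (S (y, z t))⁻¹) * jetNorm a b x t fun y ↦ (S' (y, z t))⁻¹))
        + (jetNorm a b x t (fun y ↦ V (y, z t) - V' (y, z t)) *
            jetNorm a b x t (fun y ↦ Real.log (S (y, z t) / d))
          + jetNorm a b x t (fun y ↦ -V' (y, z t)) * jetNorm a b x t fun y ↦
            Real.log (1 + (S' (y, z t) - S (y, z t)) * (S (y, z t))⁻¹))))
      =o[𝓝[≠] 0] fun t ↦ t ^ 2 := by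
    refine ((nU.mul_isBigO nI).congr' EventuallyEq.rfl (cancel (by norm_num))).add
      (IsLittleO.add ?_ (IsLittleO.add ?_ ?_))
    · refine (nU'.mul_isLittleO (nK.mul_isBigO (nI.mul nI'))).congr' EventuallyEq.rfl ?_
      filter_upwards [self_mem_nhdsWithin] with t ht
      have : t ≠ 0 := ht
      field_simp
    · refine (nW.mul_isLittleO nL).congr' EventuallyEq.rfl ?_
      simpa using cancel (m := 3) (n := 2) (k := 1) (by norm_num)
    · refine ((nV'.mul_isLittleO nM).congr_right fun t ↦ one_mul _).trans
        (isLittleO_pow_pow_punctured (by norm_num))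
  refine IsBigO.trans_isLittleO (IsBigO.of_bound 1 ?_) hbound
  have h1K : ∀ᶠ t in 𝓝[≠] 0, 1 + (S' (x, z t) - S (x, z t)) * (S (x, z t))⁻¹ ≠ 0 := by
    filter_upwards [hS0, hS0'] with t h1 h2
    rw [sub_mul, mul_inv_cancel₀ h1]
    simpa using ⟨h2, h1⟩
  filter_upwards [rS, rS', rU, rU', rV, rV', hS0, hS0', rKI, h1K]
    with t r1 r2 r3 r4 r5 r6 h1 h2 r7 h3
  rw [one_mul, Real.norm_of_nonneg (jetNorm_nonneg _)]
  have heq : (fun y ↦ hadamardDiff d S S' U U' V V' (y, z t)) =ᶠ[𝓝 x] fun y ↦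
      (U (y, z t) - U' (y, z t)) * (S (y, z t))⁻¹
      + (U' (y, z t) * ((S' (y, z t) - S (y, z t)) * ((S (y, z t))⁻¹ * (S' (y, z t))⁻¹))
        + ((V (y, z t) - V' (y, z t)) * Real.log (S (y, z t) / d)
          + -V' (y, z t) * Real.log (1 + (S' (y, z t) - S (y, z t)) * (S (y, z t))⁻¹))) := by
    filter_upwards [r1.continuousAt.eventually_ne h1, r2.continuousAt.eventually_ne h2] with y e1 e2
    exact hadamardDiff_eq hd U U' V V' e1 e2
  rw [jetNorm_congr heq]
  have i1 := r1.inv h1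
  have i2 := r2.inv h2
  have i3 : ContDiffAt ℝ 2 (fun y ↦ Real.log (S (y, z t) / d)) x :=
    (r1.div_const d).log (div_ne_zero h1 hd)
  have i4 : ContDiffAt ℝ 2
      (fun y ↦ Real.log (1 + (S' (y, z t) - S (y, z t)) * (S (y, z t))⁻¹)) x :=
    (contDiffAt_const.add r7).log h3
  refine le_trans ?_ (Real.le_norm_self _)
  have t1 := (r3.sub r4).mul i1
  have t2 := r4.mul ((r2.sub r1).mul (i1.mul i2))
  have t3 := (r5.sub r6).mul i3
  have t4 := r6.neg.mul i4
  refine (jetNorm_add_le t1 (t2.add (t3.add t4))).trans (add_le_add (jetNorm_mul_le (r3.sub r4) i1)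
    ((jetNorm_add_le t2 (t3.add t4)).trans (add_le_add ?_ ((jetNorm_add_le t3 t4).trans
      (add_le_add (jetNorm_mul_le (r5.sub r6) i3) (jetNorm_mul_le r6.neg i4))))))
  refine (jetNorm_mul_le r4 ((r2.sub r1).mul (i1.mul i2))).trans
    (mul_le_mul_of_nonneg_left ?_ (jetNorm_nonneg _))
  exact (jetNorm_mul_le (r2.sub r1) (i1.mul i2)).trans
    (mul_le_mul_of_nonneg_left (jetNorm_mul_le i1 i2) (jetNorm_nonneg _))

end HadamardDifference

/-! ### Signs along the trajectory and near a point -/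

theorem eventually_pos_of_tendsto_div_sq {s : ℝ → ℝ} {c : ℝ} (hc : 0 < c)
    (hlim : Tendsto (fun t ↦ s t / t ^ 2) (𝓝[≠] 0) (𝓝 c)) : ∀ᶠ t in 𝓝[≠] 0, 0 < s t := by
  filter_upwards [hlim.eventually_const_lt hc, self_mem_nhdsWithin] with t ht ht0
  have h2 : 0 < t ^ 2 := sq_pos_of_ne_zero ht0
  exact (div_pos_iff_of_pos_right h2).1 ht

theorem eventually_neg_of_tendsto_div_sq {s : ℝ → ℝ} {c : ℝ} (hc : c < 0)
    (hlim : Tendsto (fun t ↦ s t / t ^ 2) (𝓝[≠] 0) (𝓝 c)) : ∀ᶠ t in 𝓝[≠] 0, s t < 0 := by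
  have h := eventually_pos_of_tendsto_div_sq (s := fun t ↦ -s t) (neg_pos.2 hc)
    (hlim.neg.congr fun t ↦ (neg_div _ _).symm)
  exact h.mono fun t ht ↦ neg_pos.1 ht

theorem eventually_sign_eq {X : Type*} [TopologicalSpace X] {f : X → ℝ} {x : X}
    (hf : ContinuousAt f x) (hx : f x ≠ 0) :
    ∀ᶠ y in 𝓝 x, f y ≠ 0 ∧ SignType.sign (f y) = SignType.sign (f x) := by
  rcases lt_or_gt_of_ne hx with h | h
  · filter_upwards [hf.eventually_lt_const h] with y hy
    exact ⟨hy.ne, by rw [sign_neg hy, sign_neg h]⟩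
  · filter_upwards [hf.eventually_const_lt h] with y hy
    exact ⟨hy.ne', by rw [sign_pos hy, sign_pos h]⟩

theorem norm_sign_cast_le (r : ℝ) : ‖(SignType.sign r : ℂ)‖ ≤ 1 := by
  rcases lt_trichotomy r 0 with h | rfl | h
  · simp [sign_neg h]
  · simp
  · simp [sign_pos h]

section Coincidence

variable {M : Type*} [TopologicalSpace M] [ChartedSpace E4 M] [IsManifold (𝓡 4) ∞ M]

/-! ### The coincidence limit of the Hadamard parametrix and its approximation -/

theorem IsSplitPointApprox.mono {g : LorentzMetric M} {D : Set M} {m n : ℕ} {A B : M → M → ℝ}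
    (h : IsSplitPointApprox g D n A B) (hmn : m ≤ n) : IsSplitPointApprox g D m A B :=
  ⟨h.1.of_le (by exact_mod_cast hmn), h.2.1.of_le (by exact_mod_cast hmn),
    fun k hk ↦ h.2.2 k (hk.trans hmn)⟩

theorem IsSplitPointApprox.symm {g : LorentzMetric M} {D : Set M} {n : ℕ} {A B : M → M → ℝ}
    (h : IsSplitPointApprox g D n A B) : IsSplitPointApprox g D n B A :=
  ⟨h.2.1, h.1, fun k hk a x hx ↦ (h.2.2 k hk a x hx).imp fun _ hL ↦ hL.symm⟩

theorem IsSplitPointApprox.eventually_vanishesToOrder {g : LorentzMetric M} {D : Set M} {n : ℕ}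
    {A B : M → M → ℝ} (h : IsSplitPointApprox g D n A B) (hD : IsOpen D) {x : M} (hx : x ∈ D) :
    ∀ᶠ w in 𝓝 (extChartAt (𝓡 4) x x),
      VanishesToOrder w n (fun y ↦ biChart x A (y, w) - biChart x B (y, w)) := by
  have hDn : ∀ᶠ y in 𝓝 (extChartAt (𝓡 4) x x), (extChartAt (𝓡 4) x).symm y ∈ D :=
    (continuousAt_extChartAt_symm x).eventually (hD.mem_nhds (by rwa [extChartAt_to_inv]))
  filter_upwards [extChartAt_target_mem_nhds (I := 𝓡 4) x, hDn] with y hy hyD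
  exact h.vanishesToOrder hD hy hyD

theorem branchLog_div_sq {l : ℝ} (hl : 0 < l) (τ s : ℝ) :
    branchLog τ (s / l ^ 2) = (Real.log (s / l ^ 2) : ℂ)
      + if s < 0 then (SignType.sign τ : ℂ) * Real.pi * Complex.I else 0 := by
  have : s / l ^ 2 < 0 ↔ s < 0 := by
    rw [div_lt_iff₀ (by positivity), zero_mul]
  simp only [branchLog, this, Real.log_abs]

/-- Once `S` and `S'` have the same sign, both logarithms jump by the same `± π i`, so the branch
contributes only through `V - V'`. -/
theorem hadamardH_sub_approxH (g : LorentzMetric M) (D : Set M) (T : M → ℝ) {l : ℝ} (hl : 0 < l)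
    (V σa Ua Va : M → M → ℝ) {x x' : M} (hs : halfSqDist g D x x' ≠ 0)
    (hτ : halfSqDist g D x x' < 0 → T x ≠ T x') (hsign : halfSqDist g D x x' < 0 ↔ σa x x' < 0) :
    hadamardH g D T l V x x' - approxH T l σa Ua Va x x' =
      1 / (8 * (Real.pi : ℂ) ^ 2) *
        ((hadamardU g D x x' / halfSqDist g D x x' - Ua x x' / σa x x'
          + (V x x' * Real.log (halfSqDist g D x x' / l ^ 2)
            - Va x x' * Real.log (σa x x' / l ^ 2)) : ℝ) : ℂ)
      + 1 / (8 * (Real.pi : ℂ) ^ 2) *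
        (if halfSqDist g D x x' < 0 then
          (SignType.sign (T x - T x') : ℂ) * Real.pi * Complex.I else 0)
        * ((V x x' - Va x x' : ℝ) : ℂ) := by
  rw [hadamardH_eq g D T hl V hs hτ, approxH, branchLog_div_sq hl, branchLog_div_sq hl]
  simp only [← hsign]
  have h8 : (2 * (2 * (Real.pi : ℂ)) ^ 2) = 8 * (Real.pi : ℂ) ^ 2 := by ring
  rw [h8]
  push_cast
  ring

theorem nablaAt_two {F : Type*} [NormedAddCommGroup F] [NormedSpace ℝ F] (g : LorentzMetric M)
    (a b : Fin 4) (f : M → F) (x : M) :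
    nablaAt g 2 ![a, b] f x =
      pderiv a (pderiv b fun y ↦ f ((extChartAt (𝓡 4) x).symm y)) (extChartAt (𝓡 4) x x)
        - ∑ c : Fin 4, christoffel g x c a b (extChartAt (𝓡 4) x x) •
          pderiv c (fun y ↦ f ((extChartAt (𝓡 4) x).symm y)) (extChartAt (𝓡 4) x x) := by
  simp [nablaAt, covD, Fin.tail]

theorem tendsto_nablaAt_two {F : Type*} [NormedAddCommGroup F] [NormedSpace ℝ F]
    (g : LorentzMetric M) {x : M} {f : ℝ → M → F}
    (hf : ∀ a b, (fun t ↦ jetNorm a b (extChartAt (𝓡 4) x x) t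
      fun y ↦ f t ((extChartAt (𝓡 4) x).symm y)) =o[𝓝[≠] 0] fun t ↦ t ^ 2) (a b : Fin 4) :
    Tendsto (fun t ↦ nablaAt g 2 ![a, b] (f t) x) (𝓝[≠] 0) (𝓝 0) := by
  have h2 : Tendsto (fun t ↦ pderiv a (pderiv b fun y ↦ f t ((extChartAt (𝓡 4) x).symm y))
      (extChartAt (𝓡 4) x x)) (𝓝[≠] 0) (𝓝 0) := by
    refine squeeze_zero_norm' ?_ (hf a b).tendsto_div_nhds_zero
    filter_upwards [self_mem_nhdsWithin] with t ht
    have ht2 : 0 < t ^ 2 := sq_pos_of_ne_zero ht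
    rw [le_div_iff₀ ht2, mul_comm, jetNorm, sq_abs]
    have : 0 ≤ ‖f t ((extChartAt (𝓡 4) x).symm (extChartAt (𝓡 4) x x))‖ := norm_nonneg _
    linarith [mul_nonneg (abs_nonneg t) (norm_nonneg (pderiv a
      (fun y ↦ f t ((extChartAt (𝓡 4) x).symm y)) (extChartAt (𝓡 4) x x))),
      mul_nonneg (abs_nonneg t) (norm_nonneg (pderiv b
      (fun y ↦ f t ((extChartAt (𝓡 4) x).symm y)) (extChartAt (𝓡 4) x x)))]
  -- The first derivatives enter through the Christoffel terms. They are read off from the jet with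
  -- both directions equal to `c`, and are even `o(t)`.
  have h1 : ∀ c, Tendsto (fun t ↦ pderiv c (fun y ↦ f t ((extChartAt (𝓡 4) x).symm y))
      (extChartAt (𝓡 4) x x)) (𝓝[≠] 0) (𝓝 0) := fun c ↦ by
    have h3 := ((hf c c).tendsto_div_nhds_zero).mul
      ((continuous_abs.tendsto (0 : ℝ)).mono_left (nhdsWithin_le_nhds (s := {0}ᶜ)))
    rw [zero_mul] at h3
    refine squeeze_zero_norm' ?_ h3
    filter_upwards [self_mem_nhdsWithin] with t ht
    have ht0 : 0 < |t| := abs_pos.2 ht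
    rw [← sq_abs, div_mul_eq_mul_div, le_div_iff₀ (by positivity), sq, ← mul_assoc]
    refine mul_le_mul_of_nonneg_right ?_ ht0.le
    rw [mul_comm, jetNorm]
    have : 0 ≤ ‖f t ((extChartAt (𝓡 4) x).symm (extChartAt (𝓡 4) x x))‖ := norm_nonneg _
    linarith [mul_nonneg (abs_nonneg t) (norm_nonneg (pderiv c
      (fun y ↦ f t ((extChartAt (𝓡 4) x).symm y)) (extChartAt (𝓡 4) x x))),
      mul_nonneg (sq_nonneg |t|) (norm_nonneg (pderiv c (pderiv c
      fun y ↦ f t ((extChartAt (𝓡 4) x).symm y)) (extChartAt (𝓡 4) x x)))]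
  simp only [nablaAt_two]
  have h4 := h2.sub (tendsto_finsetSum Finset.univ fun c _ ↦
    (h1 c).const_smul (christoffel g x c a b (extChartAt (𝓡 4) x x)))
  simpa using h4

theorem contMDiffAt_of_comp_symm {F : Type*} [NormedAddCommGroup F] [NormedSpace ℝ F] {x : M}
    {n : ℕ} {f : M → F} {h : E4 → F}
    (hfh : (fun y ↦ f ((extChartAt (𝓡 4) x).symm y)) =ᶠ[𝓝 (extChartAt (𝓡 4) x x)] h)
    (hh : ContDiffAt ℝ n h (extChartAt (𝓡 4) x x)) : ContMDiffAt (𝓡 4) 𝓘(ℝ, F) n f x := by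
  have hφ : ContMDiffAt (𝓡 4) 𝓘(ℝ, E4) n (extChartAt (𝓡 4) x) x :=
    (contMDiffAt_extChartAt (n := ∞)).of_le (by exact_mod_cast le_top)
  refine (hh.contMDiffAt.comp x hφ).congr_of_eventuallyEq ?_
  filter_upwards [(continuousAt_extChartAt x).eventually hfh,
    extChartAt_source_mem_nhds (I := 𝓡 4) x] with y hy hys
  simp only [(extChartAt (𝓡 4) x).left_inv hys] at hy
  simpa using hy

/-- By the chain rule `T ∘ γ` has derivative `dT(v)` at `0`, and this is nonzero on timelike
vectors. -/
theorem IsTimeFunctionOn.eventually_ne {g : LorentzMetric M} {D : Set M} {T : M → ℝ}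
    (hT : IsTimeFunctionOn g T D) (hD : IsOpen D) {γ : ℝ → M} (hx : γ 0 ∈ D)
    (hγ : MDifferentiableAt 𝓘(ℝ, ℝ) (𝓡 4) γ 0) {v : E4}
    (hv : mfderiv 𝓘(ℝ, ℝ) (𝓡 4) γ 0 (1 : ℝ) = v) (hneg : g.val (γ 0) v v < 0) :
    ∀ᶠ t in 𝓝[≠] (0 : ℝ), T (γ 0) ≠ T (γ t) := by
  have hTd : MDifferentiableAt (𝓡 4) 𝓘(ℝ, ℝ) T (γ 0) :=
    (hT.1.contMDiffAt (hD.mem_nhds hx)).mdifferentiableAt (by simp)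
  have hv0 : v ≠ 0 := by
    rintro rfl
    exact hneg.ne (map_zero _)
  have hne : mfderiv (𝓡 4) 𝓘(ℝ, ℝ) T (γ 0) v ≠ (0 : ℝ) := hT.2 _ hx v hv0 hneg.le
  have hcomp := hTd.hasMFDerivAt.comp (0 : ℝ) hγ.hasMFDerivAt
  obtain ⟨L, hL⟩ : ∃ L : ℝ →L[ℝ] ℝ, L = (mfderiv (𝓡 4) 𝓘(ℝ, ℝ) T (γ 0)).comp
      (mfderiv 𝓘(ℝ, ℝ) (𝓡 4) γ 0) := ⟨_, rfl⟩
  have hder : HasFDerivAt (T ∘ γ) L 0 := by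
    rw [hL]
    exact hasMFDerivAt_iff_hasFDerivAt.1 hcomp
  have hL1 : L 1 ≠ 0 := by
    rw [hL]
    intro h
    apply hne
    rw [← hv]
    exact h
  exact (hder.hasDerivAt.eventually_ne hL1 (c := T (γ 0))).mono fun t ht ↦ ht.symm

end Coincidence

end PointSplitting

end

/-! ### The coincidence limit in the chart at the base point -/

open PointSplitting in
theorem mainTheorem1 {M : Type*} [TopologicalSpace M] [ChartedSpace E4 M]
    [IsManifold (𝓡 4) ∞ M] (g : LorentzMetric M)
    (D : Set M) (hD : IsConvexNormal g D)
    (T : M → ℝ) (hT : IsTimeFunctionOn g T D)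
    (m ξ l : ℝ) (hl : 0 < l)
    (V : M → M → ℝ) (hV : IsHadamardV g D m ξ V)
    (σa Ua Va : M → M → ℝ) (nσ nU nV : ℕ) (hnσ : 6 ≤ nσ) (hnU : 4 ≤ nU) (hnV : 2 ≤ nV)
    (hσa : IsSplitPointApprox g D nσ (halfSqDist g D) σa)
    (hUa : IsSplitPointApprox g D nU (hadamardU g D) Ua)
    (hVa : IsSplitPointApprox g D nV V Va) (hVa3 : BiscalarOn 3 D Va) :
    ∀ x ∈ D, ∀ γ : ℝ → M, IsNonNullTrajectory g x γ →
      (∀ᶠ t in 𝓝[≠] (0 : ℝ), ContMDiffAt (𝓡 4) 𝓘(ℝ, ℂ) 2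
        (fun y ↦ hadamardH g D T l V y (γ t) - approxH T l σa Ua Va y (γ t)) x) ∧
      ∀ a b : Fin 4, Tendsto
        (fun t ↦ nablaAt g 2 ![a, b]
          (fun y ↦ hadamardH g D T l V y (γ t) - approxH T l σa Ua Va y (γ t)) x)
        (𝓝[≠] (0 : ℝ)) (𝓝 0) := by
  rintro _ hx γ ⟨rfl, hmd, hnn⟩
  obtain ⟨v, hv⟩ : ∃ v : E4, mfderiv 𝓘(ℝ, ℝ) (𝓡 4) γ 0 (1 : ℝ) = v := ⟨_, rfl⟩
  have hgv : g.val (γ 0) v v ≠ 0 := by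
    have : ∀ w : E4, mfderiv 𝓘(ℝ, ℝ) (𝓡 4) γ 0 (1 : ℝ) = w → g.val (γ 0) w w ≠ 0 := by
      rintro _ rfl
      exact hnn
    exact this v hv
  have hDo := hD.isOpen
  have σa6 := hσa.mono hnσ
  have Ua4 := hUa.mono hnU
  have Va2 := hVa.mono hnV
  have hmem := mem_extChartAt_target (I := 𝓡 4) (γ 0)
  have hxD : (extChartAt (𝓡 4) (γ 0)).symm (extChartAt (𝓡 4) (γ 0) (γ 0)) ∈ D := by
    rwa [extChartAt_to_inv]
  have reg : ∀ {n : ℕ} {A : M → M → ℝ}, BiscalarOn n D A → ContDiffAt ℝ n (biChart (γ 0) A)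
      (extChartAt (𝓡 4) (γ 0) (γ 0), extChartAt (𝓡 4) (γ 0) (γ 0)) := fun hA ↦
    hA.contDiffAt_biChart hDo hmem hmem hxD hxD
  have cS := reg σa6.1
  have cS' := reg σa6.2.1
  have cU := reg Ua4.1
  have cU' := reg Ua4.2.1
  have hle : ∀ n : ℕ, (n : WithTop ℕ∞) ≤ ∞ := fun n ↦ by exact_mod_cast le_top
  have cV := reg (n := 3) (hV.1.of_le (hle 3))
  have cV' := reg (n := 3) hVa3
  have vS := σa6.symm.eventually_vanishesToOrder hDo hx
  have vU := Ua4.eventually_vanishesToOrder hDo hx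
  have vV := Va2.eventually_vanishesToOrder hDo hx
  have hz := hasDerivAt_extChartAt_comp rfl hmd hv
  have hpd := hD.pd_halfSqDist_self hx
  have hlim := hD.tendsto_halfSqDist_div_sq hx (z := fun t ↦ extChartAt (𝓡 4) (γ 0) (γ t)) rfl hz
  set x₀ := extChartAt (𝓡 4) (γ 0) (γ 0) with hx₀
  set z : ℝ → E4 := fun t ↦ extChartAt (𝓡 4) (γ 0) (γ t) with hzdef
  set S := biChart (γ 0) (halfSqDist g D) with hS
  set S' := biChart (γ 0) σa with hS'
  set U := biChart (γ 0) (hadamardU g D) with hU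
  set U' := biChart (γ 0) Ua with hU'
  set W := biChart (γ 0) V with hW
  set W' := biChart (γ 0) Va with hW'
  set c : ℝ := 1 / 2 * g.val (γ 0) v v with hc
  have hc0 : c ≠ 0 := mul_ne_zero (by norm_num) hgv
  have hl2 : l ^ 2 ≠ 0 := (pow_pos hl 2).ne'
  have hlim' : Tendsto (fun t ↦ S' (x₀, z t) / t ^ 2) (𝓝[≠] 0) (𝓝 c) := by
    have h1 := isLittleO_of_vanishesToOrder (cS'.sub cS) vS
    have h2 := ((h1.comp_tendsto (tendsto_pair hz rfl)).trans_isBigO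
      ((isBigO_norm_sub hz rfl).pow 6)).trans
      (isLittleO_pow_pow_punctured (by norm_num : 2 < 6))
    exact tendsto_div_sq_of_isLittleO hlim h2
  have hS0 := eventually_ne_zero_of_tendsto_div_sq hc0 hlim
  have hS0' := eventually_ne_zero_of_tendsto_div_sq hc0 hlim'
  set κ : ℂ := 1 / (8 * (Real.pi : ℂ) ^ 2) with hκ
  -- The branch contribution, with `y` frozen at the base point: for each small `t` the signs of `S`
  -- and of the time difference are constant in `y` near it, so `w t` is a true constant there.
  set w : ℝ → ℂ := fun t ↦ κ * (if c < 0 then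
    (SignType.sign (T (γ 0) - T (γ t)) : ℂ) * Real.pi * Complex.I else 0) with hw
  have hsrc : ∀ᶠ t in 𝓝[≠] (0 : ℝ), γ t ∈ (extChartAt (𝓡 4) (γ 0)).source :=
    (hmd.continuousAt.eventually (extChartAt_source_mem_nhds (γ 0))).filter_mono
      nhdsWithin_le_nhds
  have hTne : ∀ᶠ t in 𝓝[≠] (0 : ℝ), c < 0 → T (γ 0) ≠ T (γ t) := by
    by_cases hneg : c < 0
    · exact (hT.eventually_ne hDo hx hmd hv (by rw [hc] at hneg; linarith)).mono fun t ht _ ↦ ht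
    · exact Eventually.of_forall fun t h ↦ absurd h hneg
  have hsgn : ∀ {R : E4 × E4 → ℝ}, Tendsto (fun t ↦ R (x₀, z t) / t ^ 2) (𝓝[≠] 0) (𝓝 c) →
      ∀ᶠ t in 𝓝[≠] (0 : ℝ), (R (x₀, z t) < 0 ↔ c < 0) := by
    intro R hR
    rcases lt_or_gt_of_ne hc0 with h | h
    · exact (eventually_neg_of_tendsto_div_sq h hR).mono fun t ht ↦ iff_of_true ht h
    · exact (eventually_pos_of_tendsto_div_sq h hR).mono fun t ht ↦
        iff_of_false ht.not_gt h.not_gt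
  have hTc : ContinuousAt (fun y ↦ T ((extChartAt (𝓡 4) (γ 0)).symm y)) x₀ :=
    ContinuousAt.comp (g := T) (hT.1.contMDiffAt (hDo.mem_nhds hxD)).continuousAt
      (continuousAt_extChartAt_symm (γ 0))
  have hTx : T ((extChartAt (𝓡 4) (γ 0)).symm x₀) = T (γ 0) := by rw [hx₀, extChartAt_to_inv]
  -- The neighbourhood of `x₀` may shrink with `t`; this is harmless because only derivatives at
  -- `x₀` are taken before `t` tends to zero.
  have hF : ∀ᶠ t in 𝓝[≠] (0 : ℝ), (fun y ↦
      hadamardH g D T l V ((extChartAt (𝓡 4) (γ 0)).symm y) (γ t)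
        - approxH T l σa Ua Va ((extChartAt (𝓡 4) (γ 0)).symm y) (γ t)) =ᶠ[𝓝 x₀] fun y ↦
      (κ • Complex.ofRealCLM) (hadamardDiff (l ^ 2) S S' U U' W W' (y, z t))
        + (w t • Complex.ofRealCLM) (W (y, z t) - W' (y, z t)) := by
    filter_upwards [hsrc, hTne, hS0, hS0', hsgn hlim, hsgn hlim',
      eventually_contDiffAt_left hz rfl cS, eventually_contDiffAt_left hz rfl cS']
      with t ht hTt h1 h2 h3 h4 r1 r2
    have sgn : ∀ {f : E4 → ℝ}, ContinuousAt f x₀ → f x₀ ≠ 0 → (f x₀ < 0 ↔ c < 0) →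
        ∀ᶠ y in 𝓝 x₀, f y ≠ 0 ∧ (f y < 0 ↔ c < 0) := fun hf hf0 hfc ↦
      (eventually_sign_eq hf hf0).mono fun y hy ↦
        ⟨hy.1, by rw [← hfc, ← sign_eq_neg_one_iff, hy.2, sign_eq_neg_one_iff]⟩
    have hτ : ∀ᶠ y in 𝓝 x₀, c < 0 → T ((extChartAt (𝓡 4) (γ 0)).symm y) - T (γ t) ≠ 0 ∧
        SignType.sign (T ((extChartAt (𝓡 4) (γ 0)).symm y) - T (γ t)) =
          SignType.sign (T (γ 0) - T (γ t)) := by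
      by_cases hneg : c < 0
      · have h5 := eventually_sign_eq
          (f := fun y ↦ T ((extChartAt (𝓡 4) (γ 0)).symm y) - T (γ t))
          (hTc.sub continuousAt_const) (by simpa only [hTx] using sub_ne_zero.2 (hTt hneg))
        simp only [hTx] at h5
        exact h5.mono fun y hy _ ↦ hy
      · exact Eventually.of_forall fun y h ↦ absurd h hneg
    filter_upwards [sgn r1.continuousAt h1 h3, sgn r2.continuousAt h2 h4, hτ] with y e1 e2 e3
    have hb : ∀ A : M → M → ℝ, A ((extChartAt (𝓡 4) (γ 0)).symm y) (γ t)
        = biChart (γ 0) A (y, z t) := fun A ↦ by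
      simp only [biChart, hzdef, (extChartAt (𝓡 4) (γ 0)).left_inv ht]
    have hbS := hb (halfSqDist g D)
    have hbS' := hb σa
    have e4 := hadamardH_sub_approxH g D T hl V σa Ua Va
      (x := (extChartAt (𝓡 4) (γ 0)).symm y) (x' := γ t) (by rw [hbS]; exact e1.1)
      (by rw [hbS]; exact fun h ↦ sub_ne_zero.1 (e3 (e1.2.1 h)).1)
      (by rw [hbS, hbS']; exact e1.2.trans e2.2.symm)
    rw [e4, hbS, hbS', hb (hadamardU g D), hb Ua, hb V, hb Va, ← hS, ← hS', ← hU, ← hU', ← hW,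
      ← hW', ← hκ]
    have e5 : (if S (y, z t) < 0 then
        (SignType.sign (T ((extChartAt (𝓡 4) (γ 0)).symm y) - T (γ t)) : ℂ) * Real.pi * Complex.I
        else 0) = if c < 0 then
        (SignType.sign (T (γ 0) - T (γ t)) : ℂ) * Real.pi * Complex.I else 0 := by
      by_cases hneg : c < 0
      · rw [if_pos hneg, if_pos (e1.2.2 hneg), (e3 hneg).2]
      · rw [if_neg hneg, if_neg fun h ↦ hneg (e1.2.1 h)]
    rw [e5]
    rfl
  have regR := eventually_contDiffAt_hadamardDiff hl2 hz rfl cS cS' cU cU' cV cV' hS0 hS0'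
  have regW : ∀ᶠ t in 𝓝[≠] (0 : ℝ), ContDiffAt ℝ 2 (fun y ↦ W (y, z t) - W' (y, z t)) x₀ :=
    (eventually_contDiffAt_left hz rfl (cV.sub cV')).mono fun t ht ↦ ht.of_le (by norm_num)
  refine ⟨?_, fun a b ↦ tendsto_nablaAt_two g (fun a b ↦ ?_) a b⟩
  · filter_upwards [hF, regR, regW] with t h1 h2 h3
    exact contMDiffAt_of_comp_symm (n := 2) h1
      (((κ • Complex.ofRealCLM).contDiff.contDiffAt.comp x₀ h2).add
        ((w t • Complex.ofRealCLM).contDiff.contDiffAt.comp x₀ h3))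
  · have nR := isLittleO_jetNorm_hadamardDiff (a := a) (b := b) hl2 hc0 hz rfl cS cS' cU cU' cV cV'
      vS vU vV hpd hlim
    have nW : (fun t ↦ jetNorm a b x₀ t fun y ↦ W (y, z t) - W' (y, z t)) =o[𝓝[≠] 0]
        fun t ↦ t ^ 2 :=
      (isBigO_jetNorm (H := fun q ↦ W q - W' q) (n := 0) hz rfl (cV.sub cV') vV).trans_isLittleO
        (isLittleO_pow_pow_punctured (by norm_num))
    -- The sign in `w t` may differ between `t < 0` and `t > 0`; boundedness is enough, since it
    -- multiplies a jet that is already `o(t ^ 2)`.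
    have hwle : ∀ t, ‖w t‖ ≤ ‖κ‖ * Real.pi := fun t ↦ by
      rw [hw, norm_mul]
      refine mul_le_mul_of_nonneg_left ?_ (norm_nonneg _)
      split_ifs
      · rw [norm_mul, norm_mul, Complex.norm_I, mul_one, Complex.norm_real,
          Real.norm_of_nonneg Real.pi_pos.le]
        exact mul_le_of_le_one_left Real.pi_pos.le (norm_sign_cast_le _)
      · simpa using Real.pi_pos.le
    refine Asymptotics.IsBigO.trans_isLittleO (Asymptotics.IsBigO.of_bound 1 ?_)
      ((nR.const_mul_left ‖κ • Complex.ofRealCLM‖).add (nW.const_mul_left (‖κ‖ * Real.pi)))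
    filter_upwards [hF, regR, regW] with t h1 h2 h3
    rw [jetNorm_congr h1, one_mul, Real.norm_of_nonneg (jetNorm_nonneg _)]
    refine le_trans ?_ (Real.le_norm_self _)
    refine (jetNorm_add_le ((κ • Complex.ofRealCLM).contDiff.contDiffAt.comp x₀ h2)
      ((w t • Complex.ofRealCLM).contDiff.contDiffAt.comp x₀ h3)).trans
      (add_le_add (jetNorm_clm_comp_le (κ • Complex.ofRealCLM) h2)
        ((jetNorm_clm_comp_le (w t • Complex.ofRealCLM) h3).trans
          (mul_le_mul_of_nonneg_right ?_ (jetNorm_nonneg _))))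
    rw [norm_smul, Complex.ofRealCLM_norm, mul_one]
    exact hwle t
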